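/- Theorem. Let $(R,\mathfrak m)$ be a Noetherian local ring and let $M$ be a finitely generated $R$-module of dimension $d>0$. Let $\mathbf x=x_1,\dots,x_r$ ($0<r\le d$) be a partial system of parameters of $M$ (that is, $x_i\in\mathfrak m$ and $\dim M/(\mathbf x)M=d-r$) which is a $d$-sequence relative to $M$, i.e. $$(x_1,\dots,x_{i-1})M:_M x_ix_j=(x_1,\dots,x_{i-1})M:_M x_j\qquad\text{for all }1\le i\le j\le r.$$ Let $S=R[T_1,\dots,T_r]$ be the polynomial ring with its standard grading, let $\mathrm H_i(\mathbf x;M)$ denote Koszul homology, put $\mathrm{gr}_{(\mathbf x)}(M)=\bigoplus_{n\ge0}(\mathbf x)^nM/(\mathbf x)^{n+1}M$, on which $T_j$ acts as multiplication by the initial form of $x_j$, and put $\mathrm H^0_{\mathfrak m}(N)=\bigcup_k(0:_N\mathfrak m^k)$. Tensor products are over $R$. Let $\mathcal M(\mathbf x;M)$ be the augmented approximation complex $$0\to \mathrm H_r(\mathbf x;M)\otimes S[-r]\to\cdots\to \mathrm H_1(\mathbf x;M)\otimes S[-1]\to \mathrm H_0(\mathbf x;M)\otimes S\to \mathrm{gr}_{(\mathbf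 x)}(M)\to0,$$ whose differential is $\sum_j\partial_j\otimes T_j$, where $\partial_j:\mathrm H_i(\mathbf x;M)\to \mathrm H_{i-1}(\mathbf x;M)$ is induced by contraction of Koszul chains with the $j$-th dual basis vector, and whose augmentation is the $S$-linear extension of $\mathrm H_0(\mathbf x;M)=M/(\mathbf x)M=[\mathrm{gr}_{(\mathbf x)}(M)]_0\subseteq\mathrm{gr}_{(\mathbf x)}(M)$. (1) For every $i$ the canonical map $\mathrm H^0_{\mathfrak m}(\mathrm H_i(\mathbf x;M))\otimes S\to \mathrm H_i(\mathbf x;M)\otimes S$ is injective with image $\mathrm H^0_{\mathfrak m}(\mathrm H_i(\mathbf x;M)\otimes S)$, and with these identifications $\mathrm H^0_{\mathfrak m}(\mathcal M(\mathbf x;M))$ is a complex of graded $S$-modules and homogeneous maps of degree $0$ $$0\to \mathrm H^0_{\mathfrak m}(\mathrm H_r(\mathbf x;M))\otimes S[-r]\to\cdots\to \mathrm H^0_{\mathfrak m}(\mathrm H_1(\mathbf x;M))\otimes S[-1]\to \mathrm H^0_{\mathfrak m}(\mathrm H_0(\mathbf x;M))\otimes S\to \mathrm H^0_{\mathfrak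 m}(\mathrm{gr}_{(\mathbf x)}(M))\to0 .$$ (2) If moreover $\mathbf x$ is amenable to $M$, i.e. $\mathrm H_i(\mathbf x;M)$ has finite length for all $i>0$, then $\mathrm H^0_{\mathfrak m}(\mathrm H_i(\mathbf x;M))=\mathrm H_i(\mathbf x;M)$ for all $i>0$, and the resulting complex of graded $S$-modules $$0\to \mathrm H_r(\mathbf x;M)\otimes S[-r]\to\cdots\to \mathrm H_1(\mathbf x;M)\otimes S[-1]\to \mathrm H^0_{\mathfrak m}(\mathrm H_0(\mathbf x;M))\otimes S\to \mathrm H^0_{\mathfrak m}(\mathrm{gr}_{(\mathbf x)}(M))\to0$$ is acyclic, i.e. exact at every place (including at both ends). -/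

import Mathlib

open scoped TensorProduct DirectSum

namespace KoszulApprox

universe u v w

/-! ### Zeroth local cohomology -/

section Gamma

variable {R : Type u} [CommRing R] (I : Ideal R)
variable (A : Type w) [CommRing A] [Algebra R A]
variable (N : Type v) [AddCommGroup N] [Module R N] [Module A N] [IsScalarTower R A N]

/-- `H^0_I(N) = ⋃ₖ (0 :_N I^k)`, as an `A`-submodule of the module `N` over the `R`-algebra `A`. -/
def gamma : Submodule A N where
  carrier := {z | ∃ k : ℕ, ∀ a ∈ I ^ k, a • z = 0}
  zero_mem' := ⟨0, fun _ _ => smul_zero _⟩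
  add_mem' := by
    rintro y z ⟨k, hk⟩ ⟨l, hl⟩
    refine ⟨k + l, fun a ha => ?_⟩
    rw [smul_add, hk a (Ideal.pow_le_pow_right (Nat.le_add_right k l) ha),
      hl a (Ideal.pow_le_pow_right (Nat.le_add_left l k) ha), add_zero]
  smul_mem' := by
    rintro c z ⟨k, hk⟩
    refine ⟨k, fun a ha => ?_⟩
    rw [← algebraMap_smul A a, smul_comm, algebraMap_smul, hk a ha, smul_zero]

variable {N}

/-- The map `H^0_I(N) → H^0_I(N')` induced by an `R`-linear map `N → N'`. -/
def gammaMap {N' : Type v} [AddCommGroup N'] [Module R N'] (f : N →ₗ[R] N') :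
    gamma I R N →ₗ[R] gamma I R N' :=
  f.restrict (by
    rintro z ⟨k, hk⟩
    exact ⟨k, fun a ha => by rw [← map_smul, hk a ha, map_zero]⟩)

end Gamma

/-! ### The Koszul complex and its homology -/

section Koszul

variable {R : Type u} [CommRing R] {r : ℕ} (x : Fin r → R) (M : Type v) [AddCommGroup M]
  [Module R M]

/-- The module of Koszul chains `K_p(x; M) = ⨁ M e_s`, where `s = {i₁ < ⋯ < i_p}` runs over the
`p`-element subsets of the index set and `e_s = e_{i₁} ∧ ⋯ ∧ e_{i_p}`. A chain is given by its
coordinates. -/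
abbrev Chain (r p : ℕ) (M : Type v) : Type v := {s : Finset (Fin r) // s.card = p} → M

variable (R) in
/-- Contraction with the `j`-th dual basis vector: `e_s ↦ (-1)^#{i ∈ s | i < j} e_{s \ {j}}` if
`j ∈ s`, and `e_s ↦ 0` otherwise. -/
def contract (p : ℕ) (j : Fin r) : Chain r (p + 1) M →ₗ[R] Chain r p M where
  toFun f s :=
    if h : j ∈ s.1 then 0
    else (-1 : R) ^ (s.1.filter (· < j)).card •
      f ⟨insert j s.1, by rw [Finset.card_insert_of_notMem h, s.2]⟩
  map_add' f g := by
    ext s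
    by_cases h : j ∈ s.1 <;> simp [h]
  map_smul' c f := by
    ext s
    by_cases h : j ∈ s.1 <;> simp [h, smul_comm c]

/-- The Koszul differential `e_{i₁} ∧ ⋯ ∧ e_{i_{p+1}} ↦ ∑ (-1)^(k-1) x_{i_k} e_{i₁} ∧ ⋯ ∧
(omit e_{i_k}) ∧ ⋯ ∧ e_{i_{p+1}}`. -/
def koszulD (p : ℕ) : Chain r (p + 1) M →ₗ[R] Chain r p M :=
  ∑ j, x j • contract R M p j

theorem contract_contract (p : ℕ) (i j : Fin r) (f : Chain r (p + 2) M) :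
    contract R M p i (contract R M (p + 1) j f) =
      -contract R M p j (contract R M (p + 1) i f) := by
  wlog hij : i ≤ j generalizing i j
  · rw [this j i (le_of_not_ge hij), neg_neg]
  rcases hij.eq_or_lt with rfl | hij
  · have : contract R M p i (contract R M (p + 1) i f) = 0 := by
      ext s
      by_cases h : i ∈ s.1 <;> simp [contract, h]
    simp [this]
  · ext s
    by_cases hi : i ∈ s.1
    · simp [contract, hi]
    by_cases hj : j ∈ s.1
    · simp [contract, hj]
    have h1 : ((insert i s.1).filter (· < j)).card = (s.1.filter (· < j)).card + 1 := by
      rw [Finset.filter_insert, if_pos hij, Finset.card_insert_of_notMem (by simp [hi])]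
    have h2 : ((insert j s.1).filter (· < i)).card = (s.1.filter (· < i)).card := by
      rw [Finset.filter_insert, if_neg (not_lt.mpr hij.le)]
    simp only [contract, LinearMap.coe_mk, AddHom.coe_mk, hi, hj, dite_false, Pi.neg_apply,
      Finset.mem_insert, hij.ne, hij.ne', or_self, h1, h2, Finset.insert_comm i j]
    rw [smul_smul, smul_smul, ← neg_smul]
    congr 1
    ring

theorem koszulD_contract (p : ℕ) (j : Fin r) (f : Chain r (p + 2) M) :
    koszulD x M p (contract R M (p + 1) j f) = -contract R M p j (koszulD x M (p + 1) f) := by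
  simp only [koszulD, LinearMap.sum_apply, LinearMap.smul_apply, map_sum, map_smul]
  rw [← Finset.sum_neg_distrib]
  exact Finset.sum_congr rfl fun i _ => by rw [contract_contract, smul_neg]

theorem koszulD_koszulD (p : ℕ) (f : Chain r (p + 2) M) :
    koszulD x M p (koszulD x M (p + 1) f) = 0 := by
  have key : ∀ i, contract R M p i (contract R M (p + 1) i f) = 0 := by
    intro i
    ext s
    by_cases h : i ∈ s.1 <;> simp [contract, h]
  have h : koszulD x M p (koszulD x M (p + 1) f) =
      ∑ i, ∑ j, (x i * x j) • contract R M p i (contract R M (p + 1) j f) := by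
    simp only [koszulD, LinearMap.sum_apply, LinearMap.smul_apply, map_sum, map_smul,
      Finset.smul_sum, smul_smul]
    rw [Finset.sum_comm]
    exact Finset.sum_congr rfl fun i _ => Finset.sum_congr rfl fun j _ => by rw [mul_comm]
  rw [h, ← Finset.sum_product']
  refine Finset.sum_involution (fun a _ => (a.2, a.1)) ?_ ?_ ?_ ?_
  · rintro ⟨i, j⟩ -
    simp only
    rw [contract_contract M p i j, mul_comm (x j), smul_neg, neg_add_cancel]
  · rintro ⟨i, j⟩ - hne heq
    simp only [Prod.mk.injEq] at heq
    obtain ⟨rfl, -⟩ := heq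
    exact hne (by simp [key])
  · simp
  · simp

/-- The Koszul cycles `Z_p(x; M)`. -/
def cycles : (p : ℕ) → Submodule R (Chain r p M)
  | 0 => ⊤
  | p + 1 => LinearMap.ker (koszulD x M p)

/-- The Koszul boundaries `B_p(x; M)`. -/
def boundaries (p : ℕ) : Submodule R (Chain r p M) := LinearMap.range (koszulD x M p)

/-- The Koszul homology `H_p(x; M) = Z_p(x; M) / B_p(x; M)`. -/
abbrev KoszulH (p : ℕ) : Type v := cycles x M p ⧸ (boundaries x M p).submoduleOf (cycles x M p)

theorem boundaries_le_cycles (p : ℕ) : boundaries x M p ≤ cycles x M p := by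
  rintro _ ⟨f, rfl⟩
  cases p with
  | zero => trivial
  | succ p => exact koszulD_koszulD x M p f

theorem contract_mem_cycles (p : ℕ) (j : Fin r) (f : Chain r (p + 1) M)
    (hf : f ∈ cycles x M (p + 1)) : contract R M p j f ∈ cycles x M p := by
  cases p with
  | zero => trivial
  | succ p =>
    have hf' : koszulD x M (p + 1) f = 0 := hf
    change koszulD x M p _ = 0
    rw [koszulD_contract, hf', map_zero, neg_zero]

theorem contract_mem_boundaries (p : ℕ) (j : Fin r) (f : Chain r (p + 1) M)
    (hf : f ∈ boundaries x M (p + 1)) : contract R M p j f ∈ boundaries x M p := by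
  obtain ⟨g, rfl⟩ := hf
  exact ⟨-contract R M (p + 1) j g, by rw [map_neg, koszulD_contract, neg_neg]⟩

/-- The map `H_{p+1}(x; M) → H_p(x; M)` induced by contraction with the `j`-th dual basis
vector. -/
def contractH (p : ℕ) (j : Fin r) : KoszulH x M (p + 1) →ₗ[R] KoszulH x M p :=
  Submodule.mapQ _ _ ((contract R M p j).restrict (contract_mem_cycles x M p j))
    fun f hf => contract_mem_boundaries x M p j f.1 hf

end Koszul

/-! ### The associated graded module -/

section Graded

variable {R : Type u} [CommRing R] {r : ℕ} (x : Fin r → R) (M : Type v) [AddCommGroup M]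
  [Module R M]

/-- The submodule `(x)^n M` of `M`. -/
def powSub (n : ℕ) : Submodule R M := Ideal.span (Set.range x) ^ n • ⊤

/-- The associated graded module `gr_{(x)}(M) = ⨁ₙ (x)^n M / (x)^{n+1} M`. -/
def Gr : Type v := ⨁ n : ℕ, (powSub x M n) ⧸ (powSub x M (n + 1)).submoduleOf (powSub x M n)

instance : AddCommGroup (Gr x M) :=
  inferInstanceAs <| AddCommGroup
    (⨁ n : ℕ, (powSub x M n) ⧸ (powSub x M (n + 1)).submoduleOf (powSub x M n))

instance : Module R (Gr x M) :=
  inferInstanceAs <| Module R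
    (⨁ n : ℕ, (powSub x M n) ⧸ (powSub x M (n + 1)).submoduleOf (powSub x M n))

/-- The inclusion of the degree `n` component of `gr_{(x)}(M)`. -/
def grOf (n : ℕ) :
    (powSub x M n) ⧸ (powSub x M (n + 1)).submoduleOf (powSub x M n) →ₗ[R] Gr x M :=
  DirectSum.lof R ℕ
    (fun n => (powSub x M n) ⧸ (powSub x M (n + 1)).submoduleOf (powSub x M n)) n

theorem smul_mem_powSub (j : Fin r) (n : ℕ) (m : M) (hm : m ∈ powSub x M n) :
    x j • m ∈ powSub x M (n + 1) := by
  unfold powSub at *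
  rw [pow_succ', mul_smul]
  exact Submodule.smul_mem_smul (Ideal.subset_span ⟨j, rfl⟩) hm

/-- Multiplication by (the initial form of) `x j` on `gr_{(x)}(M)`: it sends the class of `m` in
`(x)^n M / (x)^{n+1} M` to the class of `x j • m` in `(x)^{n+1} M / (x)^{n+2} M`. -/
def grMul (j : Fin r) : Gr x M →ₗ[R] Gr x M :=
  DirectSum.toModule R ℕ (Gr x M) fun n => grOf x M (n + 1) ∘ₗ
    Submodule.mapQ _ _
      ((LinearMap.lsmul R M (x j)).restrict (p := powSub x M n) (q := powSub x M (n + 1))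
        (smul_mem_powSub x M j n))
      fun m hm => smul_mem_powSub x M j (n + 1) m.1 hm

theorem grMul_grOf (j : Fin r) (n : ℕ) (m : powSub x M n) :
    grMul x M j (grOf x M n (Submodule.Quotient.mk m)) =
      grOf x M (n + 1) (Submodule.Quotient.mk ⟨x j • m.1, smul_mem_powSub x M j n m.1 m.2⟩) :=
  DirectSum.toModule_lof R n _

theorem gr_hom_ext {P : Type*} [AddCommGroup P] [Module R P] {f g : Gr x M →ₗ[R] P}
    (h : ∀ n (m : powSub x M n), f (grOf x M n (Submodule.Quotient.mk m)) =
      g (grOf x M n (Submodule.Quotient.mk m))) : f = g := by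
  refine DirectSum.linearMap_ext R fun n => ?_
  ext m
  exact h n m

theorem grMul_comm (i j : Fin r) : grMul x M i * grMul x M j = grMul x M j * grMul x M i := by
  refine gr_hom_ext x M fun n m => ?_
  simp only [Module.End.mul_apply, grMul_grOf]
  congr 3
  exact smul_comm _ _ _

/-- The polynomial ring `S = R[T₁, …, T_r]`. -/
abbrev S (R : Type u) [CommRing R] (r : ℕ) : Type u := MvPolynomial (Fin r) R

/-- The action of `S` on `gr_{(x)}(M)`: the variable `T_j` acts as `grMul x M j`. -/
noncomputable def grAction : S R r →ₐ[R] Module.End R (Gr x M) :=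
  haveI := Algebra.isMulCommutative_adjoin R (s := Set.range (grMul x M)) (by
    rintro _ ⟨i, rfl⟩ _ ⟨j, rfl⟩
    exact grMul_comm x M i j)
  letI : CommSemiring (Algebra.adjoin R (Set.range (grMul x M))) :=
    { (Algebra.adjoin R (Set.range (grMul x M))).toSemiring with mul_comm := fun a b => this.is_comm.comm a b }
  (Algebra.adjoin R (Set.range (grMul x M))).val.comp
    (MvPolynomial.aeval fun j =>
      (⟨grMul x M j, Algebra.subset_adjoin ⟨j, rfl⟩⟩ :
        Algebra.adjoin R (Set.range (grMul x M))))

theorem grAction_X (j : Fin r) : grAction x M (MvPolynomial.X j) = grMul x M j := by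
  simp [grAction]

noncomputable instance : Module (S R r) (Gr x M) := Module.compHom (Gr x M) (grAction x M).toRingHom

theorem gr_smul_def (s : S R r) (z : Gr x M) : s • z = grAction x M s z := rfl

instance : IsScalarTower R (S R r) (Gr x M) where
  smul_assoc a s z := by
    rw [gr_smul_def, gr_smul_def, map_smul, LinearMap.smul_apply]

/-- The degree `n` component of `gr_{(x)}(M)`. -/
def grDeg (n : ℕ) : Submodule R (Gr x M) := LinearMap.range (grOf x M n)

/-- The degree `n` component of `S[-k] ⊗ N`, that is `S_{n-k} ⊗ N`, or `0` if `n < k`. -/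
noncomputable def tensorDeg (r : ℕ) (N : Type v) [AddCommGroup N] [Module R N] (k n : ℕ) :
    Submodule R (S R r ⊗[R] N) :=
  Submodule.span R {z | ∃ (m : ℕ) (s : S R r) (a : N),
    s ∈ MvPolynomial.homogeneousSubmodule (Fin r) R m ∧ m + k = n ∧ z = s ⊗ₜ[R] a}

/-- The degree `n` component of `H^0_I(gr_{(x)}(M))`. -/
noncomputable def gammaGrDeg (I : Ideal R) (n : ℕ) : Submodule R (gamma I (S R r) (Gr x M)) :=
  (grDeg x M n).comap ((gamma I (S R r) (Gr x M)).subtype.restrictScalars R)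

/-- The family `𝒜` of `R`-submodules makes the `S`-module `N` a graded `S`-module. -/
def IsGradedModule (r : ℕ) {N : Type*} [AddCommGroup N] [Module R N] [Module (S R r) N]
    (𝒜 : ℕ → Submodule R N) : Prop :=
  DirectSum.IsInternal 𝒜 ∧
    ∀ (a b : ℕ) (s : S R r) (z : N), s ∈ MvPolynomial.homogeneousSubmodule (Fin r) R a →
      z ∈ 𝒜 b → s • z ∈ 𝒜 (a + b)

/-- The `S`-linear map `f` is homogeneous of degree `0` for the gradings `𝒜` and `ℬ`. -/
def IsGradedMap {N P : Type*} [AddCommGroup N] [Module R N] [Module (S R r) N]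
    [AddCommGroup P] [Module R P] [Module (S R r) P]
    (𝒜 : ℕ → Submodule R N) (ℬ : ℕ → Submodule R P) (f : N →ₗ[S R r] P) : Prop :=
  ∀ n, ∀ z ∈ 𝒜 n, f z ∈ ℬ n

end Graded

/-! ### The approximation complex and its zeroth local cohomology -/

section Approx

variable {R : Type u} [CommRing R] {r : ℕ} (x : Fin r → R) (M : Type v) [AddCommGroup M]
  [Module R M]

/-- The differential `∑ⱼ Tⱼ ⊗ ∂ⱼ : S[-(p+1)] ⊗ H_{p+1}(x; M) → S[-p] ⊗ H_p(x; M)` of the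
approximation complex `ℳ(x; M)`; it is induced by the Koszul differential of the sequence
`T₁, …, T_r` on `S ⊗ K(x; M)`. -/
noncomputable def approxD (p : ℕ) :
    S R r ⊗[R] KoszulH x M (p + 1) →ₗ[S R r] S R r ⊗[R] KoszulH x M p :=
  ∑ j, (MvPolynomial.X j : S R r) • (contractH x M p j).baseChange (S R r)

theorem eval_boundary_mem (f : Chain r 0 M) (hf : f ∈ boundaries x M 0) :
    f ⟨∅, rfl⟩ ∈ powSub x M 1 := by
  obtain ⟨g, rfl⟩ := hf
  simp only [koszulD, LinearMap.sum_apply, LinearMap.smul_apply, Finset.sum_apply, Pi.smul_apply]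
  refine Submodule.sum_mem _ fun j _ => smul_mem_powSub x M j 0 _ ?_
  simp [powSub]

/-- The canonical map `H_0(x; M) = M / (x)M → gr_{(x)}(M)` onto the degree `0` component. -/
noncomputable def koszulHZeroToGr : KoszulH x M 0 →ₗ[R] Gr x M :=
  grOf x M 0 ∘ₗ Submodule.mapQ _ _
    (((LinearMap.proj (⟨∅, rfl⟩ : {s : Finset (Fin r) // s.card = 0}) :
        Chain r 0 M →ₗ[R] M).restrict (p := cycles x M 0) (q := powSub x M 0))
      fun f _ => by simp [powSub])
    fun f hf => eval_boundary_mem x M f.1 hf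

/-- The augmentation `S ⊗ H_0(x; M) → gr_{(x)}(M)`, `T^α ⊗ [m] ↦ [x^α m]`, of the approximation
complex. -/
noncomputable def approxAug : S R r ⊗[R] KoszulH x M 0 →ₗ[S R r] Gr x M :=
  (koszulHZeroToGr x M).liftBaseChange (S R r)

variable (I : Ideal R)

/-- The grading of `S[-p] ⊗ H_p(x; M)`. -/
noncomputable abbrev koszulDeg (p : ℕ) : ℕ → Submodule R (S R r ⊗[R] KoszulH x M p) :=
  tensorDeg r (KoszulH x M p) p

/-- The grading of `S[-p] ⊗ H^0_I(H_p(x; M))`. -/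
noncomputable abbrev gammaDeg (p : ℕ) : ℕ → Submodule R (S R r ⊗[R] gamma I R (KoszulH x M p)) :=
  tensorDeg r (gamma I R (KoszulH x M p)) p

/-- The canonical map `S ⊗ H^0_I(H_p(x; M)) → S ⊗ H_p(x; M)`. -/
noncomputable def gammaIncl (p : ℕ) :
    S R r ⊗[R] gamma I R (KoszulH x M p) →ₗ[S R r] S R r ⊗[R] KoszulH x M p :=
  (gamma I R (KoszulH x M p)).subtype.baseChange (S R r)

/-- The differential `S[-(p+1)] ⊗ H^0_I(H_{p+1}(x; M)) → S[-p] ⊗ H^0_I(H_p(x; M))` obtained from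
that of the approximation complex by applying `H^0_I`. -/
noncomputable def gammaD (p : ℕ) :
    S R r ⊗[R] gamma I R (KoszulH x M (p + 1)) →ₗ[S R r] S R r ⊗[R] gamma I R (KoszulH x M p) :=
  ∑ j, (MvPolynomial.X j : S R r) • (gammaMap I (contractH x M p j)).baseChange (S R r)

theorem approxAug_gammaIncl_mem (z : S R r ⊗[R] gamma I R (KoszulH x M 0)) :
    approxAug x M (gammaIncl x M I 0 z) ∈ gamma I (S R r) (Gr x M) := by
  induction z using TensorProduct.induction_on with
  | zero => simp
  | add y z hy hz => rw [map_add, map_add]; exact add_mem hy hz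
  | tmul s a =>
    obtain ⟨k, hk⟩ := a.2
    have h : approxAug x M (gammaIncl x M I 0 (s ⊗ₜ a)) = s • koszulHZeroToGr x M a.1 := by
      simp [approxAug, gammaIncl]
    rw [h]
    refine Submodule.smul_mem _ _ ⟨k, fun c hc => ?_⟩
    rw [← map_smul, hk c hc, map_zero]

/-- The augmentation `S ⊗ H^0_I(H_0(x; M)) → H^0_I(gr_{(x)}(M))` obtained from that of the
approximation complex by applying `H^0_I`. -/
noncomputable def gammaAug :
    S R r ⊗[R] gamma I R (KoszulH x M 0) →ₗ[S R r] gamma I (S R r) (Gr x M) :=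
  (approxAug x M ∘ₗ gammaIncl x M I 0).codRestrict _ (approxAug_gammaIncl_mem x M I)

end Approx

/-! ### Conditions on sequences -/

section Conditions

variable {R : Type u} [CommRing R] {r : ℕ} (x : Fin r → R) (M : Type v) [AddCommGroup M]
  [Module R M]

/-- `x₁, …, x_r` is a `d`-sequence relative to `M`:
`(x₁, …, x_{i-1})M :_M x_i x_j = (x₁, …, x_{i-1})M :_M x_j` for all `1 ≤ i ≤ j ≤ r`. -/
def IsDSequence : Prop :=
  ∀ i j : Fin r, i ≤ j →
    {m : M | (x i * x j) • m ∈ Ideal.span (x '' Set.Iio i) • (⊤ : Submodule R M)} =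
      {m : M | x j • m ∈ Ideal.span (x '' Set.Iio i) • (⊤ : Submodule R M)}

/-- `x₁, …, x_r` is a partial system of parameters of the module `M` over the local ring `R`:
the `x_i` lie in the maximal ideal and `dim M/(x)M = dim M - r`. -/
def IsPartialSystemOfParameters [IsLocalRing R] : Prop :=
  (∀ i, x i ∈ IsLocalRing.maximalIdeal R) ∧
    Module.supportDim R (M ⧸ Ideal.span (Set.range x) • (⊤ : Submodule R M)) + r =
      Module.supportDim R M

/-- `x₁, …, x_r` is amenable to `M`: `H_i(x; M)` has finite length for all `i > 0`. -/
def IsAmenable : Prop := ∀ i : ℕ, 0 < i → IsFiniteLength R (KoszulH x M i)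

end Conditions

end KoszulApprox

/-! Part (1) is formal. `S` is free over `R`, so being killed by a power of the maximal ideal can be
tested on the coefficients of monomials (`range_gamma_baseChange`), and the differentials restrict.

For part (2) the core is that a `d`-sequence makes the whole approximation complex exact, with no
finiteness condition (`exact_approxD`, `exact_approxD_approxAug`). On Koszul chains with
coefficients in M[T] there are two anticommuting differentials, `dx = ∑ x_j ∂_j` and `dT = ∑ T_j
∂_j`, and the approximation complex is the `dx`-homology with the differential induced by `dT`. A
cycle is thus a chain f with dx f = 0, dT f in the image of dx, and, at T = x, degree m part in
(x)^{m+1} M (`IsApproxCycle`). One must write f = dT g + dx k with dx g = 0.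

The proof is by induction on r and then on the weight of f. Modulo x_0 M, T_0 and e_0, the chain f
is a cycle for the remaining elements, which form a `d`-sequence on M/x_0 M. Lifting a solution from
there, one may assume that every term of f involves T_0 or e_0 (`exists_part_sub_eq_zero`). Put L =
0 :_M x_0. The terms involving e_0 but not T_0 have coefficients in L. Since (x)L = 0 and L ∩ (x)M =
0, they form a `dT`-cycle over L, hence a `dT`-boundary, and are removed. What is left is T_0 w with
w again a cycle, of smaller weight (`exists_eq_dT_add_shift`). The condition at T = x passes to w
because x_0 M ∩ (x)^{n+1} M = x_0 (x)^n M, a case of `inf_powSub_le`.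

In the amenable case the terms of positive index are already torsion, so exactness survives the
passage to zeroth local cohomology. Surjectivity onto the torsion of gr holds because the kernel of
the augmentation is a quotient of S ⊗ H_1 and is killed by a power of the maximal ideal. -/

namespace KoszulApprox

universe u v

/-! ### Koszul chains with polynomial coefficients -/

section PolyChain

variable {R : Type u} [CommRing R] {r : ℕ} {M : Type v} [AddCommGroup M] [Module R M]

/-- Koszul chains of all degrees whose coefficients are families of elements of `M` indexed by
monomials: the coordinate at `α` belongs to the basis vector `e_s` with `s = {i | (α i).1}` and the
monomial with exponents `i ↦ (α i).2`. -/
abbrev PolyChain (r : ℕ) (M : Type v) : Type v := (Fin r → Bool × ℕ) → M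

/-- The sign of the contraction with the `j`-th dual basis vector. -/
def sgn (R : Type u) [CommRing R] (α : Fin r → Bool × ℕ) (j : Fin r) : R :=
  ∏ i, if i < j ∧ (α i).1 = true then -1 else 1

theorem sgn_zero (α : Fin (r + 1) → Bool × ℕ) : sgn R α 0 = 1 := by
  simp [sgn]

theorem sgn_cons_succ (p : Bool × ℕ) (α : Fin r → Bool × ℕ) (j : Fin r) :
    sgn R (Fin.cons p α : Fin (r + 1) → Bool × ℕ) j.succ =
      (if p.1 = true then -1 else 1) * sgn R α j := by
  simp [sgn, Fin.prod_univ_succ]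

/-- The Koszul differential of the sequence `x` in `R`. -/
def dx (x : Fin r → R) : PolyChain r M →ₗ[R] PolyChain r M where
  toFun f α := ∑ j, if (α j).1 = true then 0 else
    sgn R α j • x j • f (Function.update α j (true, (α j).2))
  map_add' f g := by
    ext α
    simp only [Pi.add_apply, smul_add, ← Finset.sum_add_distrib]
    exact Finset.sum_congr rfl fun j _ => by split_ifs <;> simp
  map_smul' c f := by
    ext α
    simp only [Pi.smul_apply, RingHom.id_apply, Finset.smul_sum]
    refine Finset.sum_congr rfl fun j _ => ?_
    split_ifs
    · simp
    · rw [smul_comm (x j) c, smul_comm _ c]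

variable (R) in
/-- The Koszul differential of the sequence of variables. -/
def dT : PolyChain r M →ₗ[R] PolyChain r M where
  toFun f α := ∑ j, if (α j).1 = true ∨ (α j).2 = 0 then 0 else
    sgn R α j • f (Function.update α j (true, (α j).2 - 1))
  map_add' f g := by
    ext α
    simp only [Pi.add_apply, ← Finset.sum_add_distrib]
    exact Finset.sum_congr rfl fun j _ => by split_ifs <;> simp
  map_smul' c f := by
    ext α
    simp only [Pi.smul_apply, RingHom.id_apply, Finset.smul_sum]
    refine Finset.sum_congr rfl fun j _ => ?_
    split_ifs
    · simp
    · rw [smul_comm _ c]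

theorem dx_apply (x : Fin r → R) (f : PolyChain r M) (α : Fin r → Bool × ℕ) :
    dx x f α = ∑ j, if (α j).1 = true then 0 else
      sgn R α j • x j • f (Function.update α j (true, (α j).2)) := rfl

theorem dT_apply (f : PolyChain r M) (α : Fin r → Bool × ℕ) :
    dT R f α = ∑ j, if (α j).1 = true ∨ (α j).2 = 0 then 0 else
      sgn R α j • f (Function.update α j (true, (α j).2 - 1)) := rfl

/-- The part of a chain with prescribed entry for the first index. -/
def part (f : PolyChain (r + 1) M) (b : Bool) (i : ℕ) : PolyChain r M :=
  fun α => f (Fin.cons (b, i) α)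

/-- The chain with prescribed parts. -/
def glue (a : Bool → ℕ → PolyChain r M) : PolyChain (r + 1) M :=
  fun α => a (α 0).1 (α 0).2 (Fin.tail α)

@[simp] theorem part_glue (a : Bool → ℕ → PolyChain r M) (b : Bool) (i : ℕ) :
    part (glue a) b i = a b i := rfl

theorem part_ext {f g : PolyChain (r + 1) M} (h : ∀ b i, part f b i = part g b i) : f = g := by
  ext α
  have := congrFun (h (α 0).1 (α 0).2) (Fin.tail α)
  simpa [part] using this

@[simp] theorem part_add (f g : PolyChain (r + 1) M) (b : Bool) (i : ℕ) :
    part (f + g) b i = part f b i + part g b i := rfl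

@[simp] theorem part_sub (f g : PolyChain (r + 1) M) (b : Bool) (i : ℕ) :
    part (f - g) b i = part f b i - part g b i := rfl

@[simp] theorem part_neg (f : PolyChain (r + 1) M) (b : Bool) (i : ℕ) :
    part (-f) b i = -part f b i := rfl

@[simp] theorem part_zero (b : Bool) (i : ℕ) :
    part (0 : PolyChain (r + 1) M) b i = 0 := rfl

-- These formulas present the Koszul complex as a mapping cone over the complex of the tail; every
-- induction on r rests on them.
@[simp] theorem part_dx_false (x : Fin (r + 1) → R) (f : PolyChain (r + 1) M) (i : ℕ) :
    part (dx x f) false i = dx (Fin.tail x) (part f false i) + x 0 • part f true i := by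
  ext α
  simp [part, dx_apply, Fin.sum_univ_succ, sgn_zero, sgn_cons_succ, ← Fin.cons_update, Fin.tail,
    add_comm]

@[simp] theorem part_dx_true (x : Fin (r + 1) → R) (f : PolyChain (r + 1) M) (i : ℕ) :
    part (dx x f) true i = -dx (Fin.tail x) (part f true i) := by
  ext α
  simp only [part, dx_apply, Fin.sum_univ_succ, sgn_cons_succ, ← Fin.cons_update, Fin.tail,
    Fin.cons_zero, Fin.cons_succ, if_true, Pi.neg_apply, zero_add, ← Finset.sum_neg_distrib]
  refine Finset.sum_congr rfl fun j _ => ?_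
  split_ifs <;> simp

@[simp] theorem part_dT_false_zero (f : PolyChain (r + 1) M) :
    part (dT R f) false 0 = dT R (part f false 0) := by
  ext α
  simp [part, dT_apply, Fin.sum_univ_succ, sgn_cons_succ, ← Fin.cons_update]

@[simp] theorem part_dT_false_succ (f : PolyChain (r + 1) M) (i : ℕ) :
    part (dT R f) false (i + 1) = dT R (part f false (i + 1)) + part f true i := by
  ext α
  simp [part, dT_apply, Fin.sum_univ_succ, sgn_zero, sgn_cons_succ, ← Fin.cons_update, add_comm]

@[simp] theorem part_dT_true (f : PolyChain (r + 1) M) (i : ℕ) :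
    part (dT R f) true i = -dT R (part f true i) := by
  ext α
  simp only [part, dT_apply, Fin.sum_univ_succ, sgn_cons_succ, ← Fin.cons_update,
    Fin.cons_zero, Fin.cons_succ, if_true, Pi.neg_apply, zero_add, ← Finset.sum_neg_distrib,
    true_or]
  refine Finset.sum_congr rfl fun j _ => ?_
  split_ifs <;> simp

theorem dx_of_isEmpty (x : Fin 0 → R) (f : PolyChain 0 M) : dx x f = 0 := by
  ext α
  simp [dx_apply]

theorem dT_of_isEmpty (f : PolyChain 0 M) : dT R f = 0 := by
  ext α
  simp [dT_apply]

theorem dx_dx : ∀ {r : ℕ} (x : Fin r → R) (f : PolyChain r M), dx x (dx x f) = 0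
  | 0, x, f => dx_of_isEmpty x _
  | r + 1, x, f => by
    refine part_ext fun b i => ?_
    cases b <;> simp [dx_dx (r := r)]

theorem dT_dT : ∀ {r : ℕ} (f : PolyChain r M), dT R (dT R f) = 0
  | 0, f => dT_of_isEmpty _
  | r + 1, f => by
    refine part_ext fun b i => ?_
    cases b
    · cases i <;> simp [dT_dT (r := r)]
    · simp [dT_dT (r := r)]

theorem dT_dx : ∀ {r : ℕ} (x : Fin r → R) (f : PolyChain r M),
    dT R (dx x f) = -dx x (dT R f)
  | 0, x, f => by rw [dT_of_isEmpty, dx_of_isEmpty, neg_zero]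
  | r + 1, x, f => by
    refine part_ext fun b i => ?_
    cases b
    · cases i
      · simp [dT_dx (r := r), add_comm]
      · simp [dT_dx (r := r)]
        abel
    · simp [dT_dx (r := r)]

/-- Applied both with P = M, Q = (x)M and with P = 0 :_M x_0, Q = 0. -/
theorem dx_mem {P Q : Submodule R M} (x : Fin r → R) (h : ∀ j, ∀ m ∈ P, x j • m ∈ Q)
    (f : PolyChain r M) (hf : ∀ α, f α ∈ P) (α : Fin r → Bool × ℕ) : dx x f α ∈ Q := by
  rw [dx_apply]
  refine Submodule.sum_mem _ fun j _ => ?_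
  split_ifs
  · exact zero_mem _
  · exact Submodule.smul_mem _ _ (h j _ (hf _))

theorem dT_mem {P : Submodule R M} (f : PolyChain r M) (hf : ∀ α, f α ∈ P)
    (α : Fin r → Bool × ℕ) : dT R f α ∈ P := by
  rw [dT_apply]
  refine Submodule.sum_mem _ fun j _ => ?_
  split_ifs
  · exact zero_mem _
  · exact Submodule.smul_mem _ _ (hf _)

theorem dx_comp {N : Type v} [AddCommGroup N] [Module R N] (φ : M →ₗ[R] N) (x : Fin r → R)
    (f : PolyChain r M) : dx x (φ ∘ f) = φ ∘ dx x f := by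
  ext α
  simp only [dx_apply, Function.comp_apply, map_sum]
  exact Finset.sum_congr rfl fun j _ => by split_ifs <;> simp

theorem dT_comp {N : Type v} [AddCommGroup N] [Module R N] (φ : M →ₗ[R] N)
    (f : PolyChain r M) : dT R (φ ∘ f) = φ ∘ dT R f := by
  ext α
  simp only [dT_apply, Function.comp_apply, map_sum]
  exact Finset.sum_congr rfl fun j _ => by split_ifs <;> simp

theorem dT_apply_of_exponents_eq_zero (f : PolyChain r M) (α : Fin r → Bool × ℕ)
    (h : ∀ i, (α i).2 = 0) : dT R f α = 0 := by
  simp [dT_apply, h]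

/-! ### Multiplication by the first variable -/

/-- Multiplication by the first variable. -/
def shift (f : PolyChain (r + 1) M) : PolyChain (r + 1) M :=
  glue fun b i => Nat.casesOn i 0 fun i => part f b i

/-- Division by the first variable, dropping the terms without it. -/
def unshift (f : PolyChain (r + 1) M) : PolyChain (r + 1) M :=
  glue fun b i => part f b (i + 1)

@[simp] theorem part_shift_zero (f : PolyChain (r + 1) M) (b : Bool) :
    part (shift f) b 0 = 0 := rfl

@[simp] theorem part_shift_succ (f : PolyChain (r + 1) M) (b : Bool) (i : ℕ) :
    part (shift f) b (i + 1) = part f b i := rfl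

@[simp] theorem part_unshift (f : PolyChain (r + 1) M) (b : Bool) (i : ℕ) :
    part (unshift f) b i = part f b (i + 1) := rfl

@[simp] theorem unshift_shift (f : PolyChain (r + 1) M) : unshift (shift f) = f :=
  part_ext fun _ _ => rfl

theorem shift_injective : Function.Injective (shift : PolyChain (r + 1) M → _) :=
  Function.LeftInverse.injective unshift_shift

theorem shift_add (f g : PolyChain (r + 1) M) : shift (f + g) = shift f + shift g :=
  part_ext fun b i => by cases i <;> simp

theorem shift_zero : shift (0 : PolyChain (r + 1) M) = 0 :=
  part_ext fun b i => by cases i <;> simp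

theorem dx_shift (x : Fin (r + 1) → R) (f : PolyChain (r + 1) M) :
    dx x (shift f) = shift (dx x f) :=
  part_ext fun b i => by cases i <;> cases b <;> simp

/-- There is no such rule for `dT`: contracting terms with e_0 but without T_0, which `unshift`
discards, produces terms with T_0. Hence the correction made in `exists_eq_dT_add_shift`. -/
theorem dx_unshift (x : Fin (r + 1) → R) (f : PolyChain (r + 1) M) :
    dx x (unshift f) = unshift (dx x f) :=
  part_ext fun b i => by cases b <;> simp

theorem dT_shift (f : PolyChain (r + 1) M) : dT R (shift f) = shift (dT R f) :=
  part_ext fun b i => by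
    rcases i with - | - | i <;> cases b <;> simp

/-! ### Evaluation -/

/-- Evaluation at `x` of the component of degree `m` of the coefficient of `e_∅`. -/
def ev : {r : ℕ} → (x : Fin r → R) → (m : ℕ) → PolyChain r M →ₗ[R] M
  | 0, _, 0 => (LinearMap.proj Fin.elim0 : (∀ _, M) →ₗ[R] M)
  | 0, _, _ + 1 => 0
  | _ + 1, x, m => ∑ ij ∈ Finset.HasAntidiagonal.antidiagonal m, x 0 ^ ij.1 • ev (Fin.tail x) ij.2 ∘ₗ
      { toFun := fun f => part f false ij.1
        map_add' := fun _ _ => rfl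
        map_smul' := fun _ _ => rfl }

theorem ev_succ (x : Fin (r + 1) → R) (m : ℕ) (f : PolyChain (r + 1) M) :
    ev x m f = ∑ ij ∈ Finset.HasAntidiagonal.antidiagonal m,
      x 0 ^ ij.1 • ev (Fin.tail x) ij.2 (part f false ij.1) := by
  simp [ev]
  rfl

theorem ev_succ_zero (x : Fin (r + 1) → R) (f : PolyChain (r + 1) M) :
    ev x 0 f = ev (Fin.tail x) 0 (part f false 0) := by
  simp [ev_succ]

theorem ev_succ_succ (x : Fin (r + 1) → R) (m : ℕ) (f : PolyChain (r + 1) M) :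
    ev x (m + 1) f = ev (Fin.tail x) (m + 1) (part f false 0) + x 0 • ev x m (unshift f) := by
  rw [ev_succ, ev_succ, Finset.Nat.sum_antidiagonal_succ, Finset.smul_sum]
  simp [pow_succ', mul_smul]

theorem ev_zero : ∀ {r : ℕ} (x : Fin r → R) (f : PolyChain r M),
    ev x 0 f = f fun _ => (false, 0)
  | 0, x, f => by
    simp only [ev, LinearMap.coe_proj, Function.eval]
    congr 1
    exact Subsingleton.elim _ _
  | r + 1, x, f => by
    rw [ev_succ_zero, ev_zero, part]
    congr 1
    ext i : 1
    cases i using Fin.cases <;> rfl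

/-- Substituting x_j for T_j turns ∑ T_j ∂_j into ∑ x_j ∂_j; the variable accounts for the shift of
degree. -/
theorem ev_dT : ∀ {r : ℕ} (x : Fin r → R) (m : ℕ) (f : PolyChain r M),
    ev x (m + 1) (dT R f) = ev x m (dx x f)
  | 0, x, m, f => by simp [dT_of_isEmpty, dx_of_isEmpty]
  | r + 1, x, m, f => by
    rw [ev_succ, ev_succ, Finset.Nat.sum_antidiagonal_succ]
    simp only [part_dT_false_zero, part_dT_false_succ, part_dx_false, map_add, map_smul, smul_add,
      Finset.sum_add_distrib, pow_zero, one_smul]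
    rw [ev_dT, ← add_assoc]
    congr 1
    · cases m with
      | zero => simp [ev_zero, dT_apply_of_exponents_eq_zero]
      | succ m =>
        rw [Finset.Nat.sum_antidiagonal_succ', Finset.Nat.sum_antidiagonal_succ]
        simp only [ev_dT, pow_zero, one_smul]
        simp [ev_zero, dT_apply_of_exponents_eq_zero]
    · exact Finset.sum_congr rfl fun ij _ => by rw [pow_succ, mul_smul]

theorem ev_comp {N : Type v} [AddCommGroup N] [Module R N] (φ : M →ₗ[R] N) :
    ∀ {r : ℕ} (x : Fin r → R) (m : ℕ) (f : PolyChain r M), ev x m (φ ∘ f) = φ (ev x m f)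
  | 0, _, 0, _ => rfl
  | 0, _, m + 1, _ => by simp [ev]
  | r + 1, x, m, f => by
    simp only [ev_succ, map_sum, map_smul]
    refine Finset.sum_congr rfl fun ij _ => ?_
    rw [← ev_comp]
    rfl

/-- The filtration is arbitrary because it is used for the powers (x)^n M and also for the
filtration that is 0 :_M x_0 in degree 0 and zero afterwards. -/
theorem ev_mem {P : ℕ → Submodule R M} :
    ∀ {r : ℕ} (x : Fin r → R) (_ : ∀ j n, ∀ m ∈ P n, x j • m ∈ P (n + 1)) (n m : ℕ)
      (f : PolyChain r M) (_ : ∀ α, f α ∈ P n), ev x m f ∈ P (n + m)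
  | 0, _, _, _, 0, _, hf => hf _
  | 0, _, _, _, m + 1, _, _ => by simp [ev]
  | r + 1, x, h, n, m, f, hf => by
    rw [ev_succ]
    refine Submodule.sum_mem _ fun ij hij => ?_
    have key : ∀ (k l : ℕ) (y : M), y ∈ P l → x 0 ^ k • y ∈ P (l + k) := by
      intro k
      induction k with
      | zero => intro l y hy; simpa using hy
      | succ k ih =>
        intro l y hy
        rw [pow_succ', mul_smul]
        exact h 0 _ _ (ih l y hy)
    have := key ij.1 _ _ (ev_mem (Fin.tail x) (fun j => h j.succ) n ij.2 (part f false ij.1)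
      fun α => hf _)
    rw [Finset.HasAntidiagonal.mem_antidiagonal] at hij
    convert this using 2
    omega

theorem ev_single : ∀ {r : ℕ} (x : Fin r → R) (m : ℕ) (e : Fin r → ℕ) (c : M),
    ev x m (Pi.single (fun i => (false, e i)) c) =
      if ∑ i, e i = m then (∏ i, x i ^ e i) • c else 0
  | 0, x, 0, e, c => by
    simp only [ev, LinearMap.coe_proj, Function.eval]
    rw [Subsingleton.elim (fun i => (false, e i)) Fin.elim0]
    simp
  | 0, x, m + 1, e, c => by simp [ev]
  | r + 1, x, m, e, c => by
    have hp : ∀ i, part (Pi.single (fun i => (false, e i)) c : PolyChain (r + 1) M) false i =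
        if i = e 0 then Pi.single (fun i => (false, Fin.tail e i)) c else 0 := by
      intro i
      ext α
      have : (Fin.cons (false, i) α : Fin (r + 1) → Bool × ℕ) = (fun i => (false, e i)) ↔
          i = e 0 ∧ α = fun i => (false, Fin.tail e i) := by
        rw [funext_iff, Fin.forall_fin_succ, funext_iff]
        simp [Fin.tail]
      by_cases h0 : i = e 0
      · rw [if_pos h0]
        simp only [part, Pi.single_apply, this]
        simp [h0]
      · rw [if_neg h0]
        simp [part, this, h0]
    simp only [ev_succ, hp, apply_ite (ev (Fin.tail x) _), map_zero, ev_single (r := r)]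
    rw [Fin.sum_univ_succ, Fin.prod_univ_succ]
    by_cases h : e 0 + ∑ i : Fin r, e i.succ = m
    · rw [if_pos h, Finset.sum_eq_single (e 0, ∑ i : Fin r, e i.succ)]
      · simp [Fin.tail, mul_smul]
      · rintro ⟨a, b⟩ hab hne
        rw [Finset.HasAntidiagonal.mem_antidiagonal] at hab
        simp only at hab ⊢
        by_cases ha : a = e 0
        · refine absurd (Prod.ext ha ?_) hne
          simp only
          omega
        · simp [ha]
      · simp [h]
    · rw [if_neg h]
      refine Finset.sum_eq_zero fun ij hij => ?_
      rw [Finset.HasAntidiagonal.mem_antidiagonal] at hij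
      by_cases ha : ij.1 = e 0
      · have : ∑ i, Fin.tail e i ≠ ij.2 := by
          simp only [Fin.tail]
          omega
        simp [this]
      · simp [ha]

/-! ### Truncation -/

/-- The weight of a coordinate: the degree of the monomial plus the degree of the chain. -/
def weight (α : Fin r → Bool × ℕ) : ℕ := ∑ i, ((α i).1.toNat + (α i).2)

theorem weight_update (α : Fin r → Bool × ℕ) (j : Fin r) (p : Bool × ℕ) :
    weight (Function.update α j p) + ((α j).1.toNat + (α j).2) =
      weight α + (p.1.toNat + p.2) := by
  classical
  unfold weight
  rw [← Finset.add_sum_erase _ _ (Finset.mem_univ j),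
    ← Finset.add_sum_erase (a := j) _ (fun i => (α i).1.toNat + (α i).2) (Finset.mem_univ j)]
  have : ∑ i ∈ Finset.univ.erase j, ((Function.update α j p i).1.toNat +
      (Function.update α j p i).2) = ∑ i ∈ Finset.univ.erase j, ((α i).1.toNat + (α i).2) :=
    Finset.sum_congr rfl fun i hi => by
      rw [Function.update_of_ne (Finset.ne_of_mem_erase hi)]
  rw [this]
  simp only [Function.update_self]
  ring

theorem weight_cons (p : Bool × ℕ) (α : Fin r → Bool × ℕ) :
    weight (Fin.cons p α : Fin (r + 1) → Bool × ℕ) = p.1.toNat + p.2 + weight α := by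
  simp [weight, Fin.sum_univ_succ]

/-- Truncation to weights smaller than `n`. -/
def trunc (n : ℕ) (f : PolyChain r M) : PolyChain r M := fun α => if weight α < n then f α else 0

/-- `dx` removes a basis vector and keeps the monomial, so it lowers the weight by exactly one. -/
theorem dx_trunc (x : Fin r → R) (n : ℕ) (f : PolyChain r M) :
    dx x (trunc (n + 1) f) = trunc n (dx x f) := by
  ext α
  simp only [dx_apply, trunc]
  by_cases hα : weight α < n
  · rw [if_pos hα]
    refine Finset.sum_congr rfl fun j _ => ?_
    split_ifs with h1 h2
    · rfl
    · rfl
    · have := weight_update α j (true, (α j).2)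
      simp [h1] at this
      omega
  · rw [if_neg hα]
    refine Finset.sum_eq_zero fun j _ => ?_
    split_ifs with h1 h2
    · rfl
    · have := weight_update α j (true, (α j).2)
      simp [h1] at this
      omega
    · simp

/-- `dT` trades a basis vector for a variable, so the weight is preserved. -/
theorem dT_trunc (n : ℕ) (f : PolyChain r M) : dT R (trunc n f) = trunc n (dT R f) := by
  ext α
  simp only [dT_apply, trunc]
  have key : ∀ j, ¬ ((α j).1 = true ∨ (α j).2 = 0) →
      weight (Function.update α j (true, (α j).2 - 1)) = weight α := by
    intro j hj
    have := weight_update α j (true, (α j).2 - 1)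
    simp only [not_or, Bool.not_eq_true] at hj
    simp [hj.1] at this
    omega
  by_cases hα : weight α < n
  · rw [if_pos hα]
    refine Finset.sum_congr rfl fun j _ => ?_
    split_ifs with h1 h2
    · rfl
    · rfl
    · exact absurd (key j h1 ▸ hα) h2
  · rw [if_neg hα]
    refine Finset.sum_eq_zero fun j _ => ?_
    split_ifs with h1 h2
    · rfl
    · exact absurd (key j h1 ▸ h2) hα
    · simp

theorem trunc_add (n : ℕ) (f g : PolyChain r M) : trunc n (f + g) = trunc n f + trunc n g := by
  ext α
  simp only [trunc, Pi.add_apply]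
  split_ifs <;> simp

theorem trunc_chain_zero (n : ℕ) : trunc n (0 : PolyChain r M) = 0 := by
  ext α
  simp [trunc]

theorem trunc_zero (f : PolyChain r M) : trunc 0 f = 0 := by
  ext α
  simp [trunc]

theorem dx_trunc_eq_zero (x : Fin r → R) (n : ℕ) {f : PolyChain r M} (h : dx x f = 0) :
    dx x (trunc n f) = 0 := by
  cases n with
  | zero => rw [trunc_zero, map_zero]
  | succ n => rw [dx_trunc, h, trunc_chain_zero]

theorem trunc_shift (n : ℕ) (f : PolyChain (r + 1) M) :
    trunc (n + 1) (shift f) = shift (trunc n f) := by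
  refine part_ext fun b i => ?_
  cases i with
  | zero =>
    ext α
    simp [part, trunc, shift, glue]
  | succ i =>
    ext α
    rw [part_shift_succ]
    simp only [part, trunc, weight_cons]
    have : b.toNat + (i + 1) + weight α < n + 1 ↔ b.toNat + i + weight α < n := by omega
    simp only [this]
    rfl

theorem ev_trunc : ∀ {r : ℕ} (x : Fin r → R) (n m : ℕ) (f : PolyChain r M),
    ev x m (trunc n f) = if m < n then ev x m f else 0
  | 0, x, n, 0, f => by
    simp [ev, trunc, weight]
  | 0, x, n, m + 1, f => by simp [ev]
  | r + 1, x, n, m, f => by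
    have hp : ∀ i, part (trunc n f) false i = trunc (n - i) (part f false i) := by
      intro i
      ext α
      simp only [part, trunc, weight_cons]
      have : false.toNat + i + weight α < n ↔ weight α < n - i := by
        simp only [Bool.toNat_false]
        omega
      simp only [this]
    simp only [ev_succ, hp, ev_trunc (r := r)]
    split_ifs with h
    · refine Finset.sum_congr rfl fun ij hij => ?_
      rw [Finset.HasAntidiagonal.mem_antidiagonal] at hij
      rw [if_pos (by omega)]
    · refine Finset.sum_eq_zero fun ij hij => ?_
      rw [Finset.HasAntidiagonal.mem_antidiagonal] at hij
      rw [if_neg (by omega), smul_zero]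

/-! ### Exactness for the variables -/

/-- The variables form a regular sequence on P[T], so their Koszul complex has homology only P, in
the constant coefficient of e_∅. -/
theorem exists_dT_eq : ∀ {r : ℕ} (P : Submodule R M) (f : PolyChain r M), (∀ α, f α ∈ P) →
    dT R f = 0 → (f fun _ => (false, 0)) = 0 → ∃ g : PolyChain r M, (∀ α, g α ∈ P) ∧ dT R g = f
  | 0, P, f, hP, _, h0 => by
    refine ⟨0, fun _ => zero_mem _, ?_⟩
    rw [map_zero]
    ext α
    rw [Subsingleton.elim α fun _ => (false, 0), h0]
    rfl
  | r + 1, P, f, hP, hf, h0 => by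
    obtain ⟨u, huP, hu⟩ := exists_dT_eq P (part f false 0) (fun α => hP _)
      (by rw [← part_dT_false_zero, hf, part_zero]) (by
        rw [← h0, part]
        congr 1
        ext i : 1
        cases i using Fin.cases <;> rfl)
    -- Each term T_0 t without e_0 is hit by contracting e_0 t; terms with neither T_0 nor e_0 come
    -- from the inductive solution `u`. The terms with e_0 then agree because dT f = 0.
    refine ⟨glue fun b i => bif b then part f false (i + 1) else
      Nat.casesOn i u fun _ => 0, ?_, part_ext fun b i => ?_⟩
    · intro α
      rcases h : α 0 with ⟨_ | _, _ | i⟩ <;> simp only [glue, h, cond_false, cond_true]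
      · exact huP _
      · exact zero_mem _
      · exact hP _
      · exact hP _
    · cases b
      · cases i
        · simpa using hu
        · simp
      · have := congrArg (fun g => part g false (i + 1)) hf
        simp only [part_dT_false_succ, part_zero] at this
        simp only [part_dT_true, part_glue, cond_true]
        rw [eq_comm, ← add_eq_zero_iff_eq_neg', this]

end PolyChain

/-! ### Properties of `d`-sequences -/

section DSequence

variable {R : Type u} [CommRing R] {r : ℕ} {x : Fin r → R} {M : Type v} [AddCommGroup M]
  [Module R M]

variable (x) in
/-- The ideal generated by the first `i` elements of the sequence `x`. -/
def initialIdeal (i : ℕ) : Ideal R := Ideal.span (x '' {k | k.1 < i})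

theorem initialIdeal_succ (i : Fin r) :
    initialIdeal x (i.1 + 1) = Ideal.span {x i} ⊔ initialIdeal x i.1 := by
  rw [initialIdeal, initialIdeal, ← Ideal.span_union]
  congr 1
  ext y
  simp only [Set.mem_image, Set.mem_ofPred_eq, Set.singleton_union, Set.mem_insert_iff]
  constructor
  · rintro ⟨k, hk, rfl⟩
    rcases Nat.lt_succ_iff_lt_or_eq.mp hk with h | h
    · exact Or.inr ⟨k, h, rfl⟩
    · exact Or.inl (by rw [Fin.ext h])
  · rintro (rfl | ⟨k, hk, rfl⟩)
    · exact ⟨i, Nat.lt_succ_self _, rfl⟩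
    · exact ⟨k, Nat.lt_succ_of_lt hk, rfl⟩

theorem initialIdeal_mono {i k : ℕ} (h : i ≤ k) : initialIdeal x i ≤ initialIdeal x k :=
  Ideal.span_mono (Set.image_mono fun _ hj => lt_of_lt_of_le hj h)

theorem initialIdeal_zero : initialIdeal x 0 = ⊥ := by simp [initialIdeal]

theorem initialIdeal_top : initialIdeal x r = Ideal.span (Set.range x) := by
  simp [initialIdeal, Set.image_univ]

theorem mem_initialIdeal_succ_smul (i : Fin r) (P : Submodule R M) {m : M} :
    m ∈ initialIdeal x (i.1 + 1) • P ↔ ∃ c ∈ P, ∃ y ∈ initialIdeal x i.1 • P, x i • c + y = m := by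
  rw [initialIdeal_succ, Submodule.sup_smul, Submodule.mem_sup]
  constructor
  · rintro ⟨z, hz, y, hy, rfl⟩
    rw [Submodule.ideal_span_singleton_smul, Submodule.mem_smul_pointwise_iff_exists] at hz
    obtain ⟨c, hc, rfl⟩ := hz
    exact ⟨c, hc, y, hy, rfl⟩
  · rintro ⟨c, hc, y, hy, rfl⟩
    exact ⟨_, Submodule.smul_mem_smul (Ideal.mem_span_singleton_self _) hc, y, hy, rfl⟩

theorem powSub_succ (n : ℕ) :
    powSub x M (n + 1) = Ideal.span (Set.range x) • powSub x M n := by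
  rw [powSub, powSub, pow_succ', mul_smul]

theorem powSub_anti {m n : ℕ} (h : m ≤ n) : powSub x M n ≤ powSub x M m :=
  Submodule.smul_mono_left (Ideal.pow_le_pow_right h)

theorem powSub_zero : powSub x M 0 = ⊤ := by simp [powSub]

theorem IsDSequence.smul_mem (hd : IsDSequence x M) {i j : Fin r} (hij : i ≤ j) {m : M}
    (h : (x i * x j) • m ∈ initialIdeal x i.1 • (⊤ : Submodule R M)) :
    x j • m ∈ initialIdeal x i.1 • (⊤ : Submodule R M) :=
  ((Set.ext_iff.mp (hd i j hij)) m).mp h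

theorem IsDSequence.smul_mem_of_le (hd : IsDSequence x M) {i j : Fin r} (hij : i ≤ j) {c : M}
    (h : x i • c ∈ initialIdeal x i.1 • (⊤ : Submodule R M)) :
    x j • c ∈ initialIdeal x i.1 • (⊤ : Submodule R M) := by
  refine hd.smul_mem hij ?_
  rw [mul_comm, mul_smul]
  exact Submodule.smul_mem _ _ h

/-- Descent on k, writing I_k for the ideal of the first k elements. If c = x_k m + y with y ∈ I_k
M, then x_k c ∈ I_i M, so x_k² m ∈ I_k M. The `d`-sequence condition with both indices equal to k
gives x_k m ∈ I_k M, hence c ∈ I_k M. -/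
theorem IsDSequence.mem_of_smul_mem (hd : IsDSequence x M) {i : Fin r} {c : M}
    (h : x i • c ∈ initialIdeal x i.1 • (⊤ : Submodule R M)) {k : ℕ} (hik : i.1 ≤ k) (hk : k ≤ r)
    (hc : c ∈ initialIdeal x k • (⊤ : Submodule R M)) :
    c ∈ initialIdeal x i.1 • (⊤ : Submodule R M) := by
  induction k, hik using Nat.le_induction with
  | base => exact hc
  | succ k hik ih =>
    refine ih (by omega) ?_
    obtain ⟨m, -, y, hy, rfl⟩ := (mem_initialIdeal_succ_smul ⟨k, hk⟩ _).mp hc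
    refine add_mem (hd.smul_mem le_rfl (i := ⟨k, hk⟩) ?_) hy
    have := Submodule.smul_mono_left (N := (⊤ : Submodule R M)) (initialIdeal_mono (x := x) hik)
      (hd.smul_mem_of_le (j := ⟨k, hk⟩) hik h)
    rw [smul_add] at this
    rw [mul_smul]
    exact (Submodule.add_mem_iff_left _ (Submodule.smul_mem _ _ hy)).mp this

/-- Induction on n and descending induction on i from the trivial case i = r. From i + 1 one gets z
= x_i c + y, where c lies in a positive power of (x) times M and x_i c ∈ I_i M. Then c ∈ I_i M by
`mem_of_smul_mem`, and the induction on n applies to c. -/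
theorem IsDSequence.inf_powSub_le (hd : IsDSequence x M) (n : ℕ) {i : ℕ} (hi : i ≤ r) :
    initialIdeal x i • (⊤ : Submodule R M) ⊓ powSub x M (n + 1) ≤
      initialIdeal x i • powSub x M n := by
  induction n generalizing i with
  | zero => rw [powSub_zero]; exact inf_le_left
  | succ n ihn =>
    induction hi using Nat.decreasingInduction with
    | self => rw [initialIdeal_top, powSub_succ (n + 1)]; exact inf_le_right
    | of_succ i hi ih =>
      rintro z ⟨hz, hzn⟩
      obtain ⟨c, hc, y, hy, rfl⟩ := (mem_initialIdeal_succ_smul ⟨i, hi⟩ _).mp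
        (ih ⟨Submodule.smul_mono_left (initialIdeal_mono i.le_succ) hz, hzn⟩)
      refine add_mem ?_ hy
      have h1 : x ⟨i, hi⟩ • c ∈ initialIdeal x i • (⊤ : Submodule R M) :=
        (Submodule.add_mem_iff_left _ (Submodule.smul_mono le_rfl le_top hy)).mp hz
      have h2 : c ∈ initialIdeal x i • (⊤ : Submodule R M) := by
        refine hd.mem_of_smul_mem (i := ⟨i, hi⟩) h1 (k := r) hi.le le_rfl ?_
        have := powSub_anti (Nat.le_add_left 1 n) hc
        rwa [powSub_succ, powSub_zero, ← initialIdeal_top] at this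
      have h3 := Submodule.smul_mem_smul (I := Ideal.span (Set.range x))
        (Ideal.subset_span ⟨⟨i, hi⟩, rfl⟩) (ihn hi.le ⟨h2, hc⟩)
      rwa [← mul_smul, mul_comm, mul_smul, ← powSub_succ] at h3

/-! ### The first element of a `d`-sequence and reduction modulo it -/

variable {x : Fin (r + 1) → R}

/-- With `eq_zero` below: L = 0 :_M x_0 satisfies (x)L = 0 and L ∩ (x)M = 0. -/
theorem IsDSequence.smul_eq_zero (hd : IsDSequence x M) {c : M} (hc : x 0 • c = 0)
    (j : Fin (r + 1)) : x j • c = 0 := by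
  have := hd.smul_mem_of_le (Fin.zero_le j) (c := c) (by rw [hc]; exact zero_mem _)
  simpa [initialIdeal_zero] using this

theorem IsDSequence.eq_zero (hd : IsDSequence x M) {c : M} (hc : x 0 • c = 0)
    (hm : c ∈ powSub x M 1) : c = 0 := by
  have := hd.mem_of_smul_mem (i := 0) (c := c) (by rw [hc]; exact zero_mem _) (k := r + 1)
    (Nat.zero_le _) le_rfl (by rwa [powSub_succ, powSub_zero, ← initialIdeal_top] at hm)
  simpa [initialIdeal_zero] using this

/-- The case i = 1 of `inf_powSub_le`: x_0 M ∩ (x)^{n+1} M = x_0 (x)^n M. -/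
theorem IsDSequence.exists_smul_eq (hd : IsDSequence x M) {c : M} {n : ℕ}
    (hc : x 0 • c ∈ powSub x M (n + 1)) : ∃ c' ∈ powSub x M n, x 0 • c' = x 0 • c := by
  have h0 : initialIdeal x 1 = Ideal.span {x 0} := by
    simpa [initialIdeal_zero] using initialIdeal_succ (x := x) 0
  have := hd.inf_powSub_le n (i := 1) (by omega) ⟨by
    rw [h0]; exact Submodule.smul_mem_smul (Ideal.mem_span_singleton_self _) trivial, hc⟩
  rwa [h0, Submodule.ideal_span_singleton_smul, Submodule.mem_smul_pointwise_iff_exists] at this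

variable (x M) in
/-- The submodule `x₀ M`. -/
abbrev headSub : Submodule R M := Ideal.span {x 0} • ⊤

theorem mem_headSub {m : M} : m ∈ headSub M x ↔ ∃ c, x 0 • c = m := by
  rw [headSub, Submodule.ideal_span_singleton_smul, Submodule.mem_smul_pointwise_iff_exists]
  simp

theorem mkQ_mem_smul_iff (s : Set R) (m : M) :
    (headSub M x).mkQ m ∈ Ideal.span s • (⊤ : Submodule R (M ⧸ headSub M x)) ↔
      m ∈ Ideal.span (insert (x 0) s) • (⊤ : Submodule R M) := by
  rw [← Submodule.mem_comap, ← Submodule.range_mkQ, ← Submodule.map_top, ← Submodule.map_smul'',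
    Submodule.comap_map_mkQ, Set.insert_eq, Ideal.span_union, Submodule.sup_smul]

theorem IsDSequence.tail (hd : IsDSequence x M) :
    IsDSequence (Fin.tail x) (M ⧸ headSub M x) := by
  intro i j hij
  have hI : insert (x 0) (Fin.tail x '' Set.Iio i) = x '' Set.Iio i.succ := by
    ext y
    simp only [Set.mem_insert_iff, Set.mem_image, Set.mem_Iio, Fin.tail]
    constructor
    · rintro (rfl | ⟨k, hk, rfl⟩)
      · exact ⟨0, Fin.succ_pos i, rfl⟩
      · exact ⟨k.succ, Fin.succ_lt_succ_iff.mpr hk, rfl⟩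
    · rintro ⟨k, hk, rfl⟩
      cases k using Fin.cases with
      | zero => exact Or.inl rfl
      | succ k => exact Or.inr ⟨k, Fin.succ_lt_succ_iff.mp hk, rfl⟩
  ext z
  obtain ⟨m, rfl⟩ := (headSub M x).mkQ_surjective z
  have := Set.ext_iff.mp (hd i.succ j.succ (Fin.succ_le_succ_iff.mpr hij)) m
  simp only [Set.mem_ofPred_eq, ← map_smul, mkQ_mem_smul_iff, hI]
  exact this

theorem mkQ_mem_powSub {m : M} {n : ℕ} (hm : m ∈ powSub x M n) :
    (headSub M x).mkQ m ∈ powSub (Fin.tail x) (M ⧸ headSub M x) n := by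
  induction n generalizing m with
  | zero => rw [powSub_zero]; trivial
  | succ n ih =>
    rw [powSub_succ] at hm
    refine Submodule.smul_induction_on hm (fun a ha y hy => ?_) fun y z hy hz => ?_
    · induction ha using Submodule.span_induction with
      | mem a ha =>
        obtain ⟨j, rfl⟩ := ha
        cases j using Fin.cases with
        | zero =>
          have : (headSub M x).mkQ (x 0 • y) = 0 := by
            rw [← LinearMap.mem_ker, Submodule.ker_mkQ]
            exact mem_headSub.mpr ⟨y, rfl⟩
          rw [this]
          exact zero_mem _
        | succ j =>
          rw [map_smul]
          exact smul_mem_powSub (Fin.tail x) _ j n _ (ih hy)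
      | zero => rw [zero_smul, map_zero]; exact zero_mem _
      | add a b _ _ ha hb => rw [add_smul, map_add]; exact add_mem ha hb
      | smul c a _ ha => rw [smul_assoc, map_smul]; exact Submodule.smul_mem _ _ ha
    · rw [map_add]; exact add_mem hy hz

end DSequence

/-! ### Acyclicity at the level of chains -/

section Acyclic

variable {R : Type u} [CommRing R] {r : ℕ} {M : Type v} [AddCommGroup M] [Module R M]

/-- The chain `f` with polynomial coefficients represents a cycle of the approximation complex. -/
structure IsApproxCycle (x : Fin r → R) (f : PolyChain r M) : Prop where
  dx_eq : dx x f = 0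
  dT_eq : ∃ h, dT R f = dx x h
  ev_mem : ∀ m, ev x m f ∈ powSub x M (m + 1)

theorem dx_mem_powSub (x : Fin r → R) (f : PolyChain r M) (α : Fin r → Bool × ℕ) :
    dx x f α ∈ powSub x M 1 :=
  dx_mem (P := ⊤) x (fun j m _ => smul_mem_powSub x M j 0 m (by simp [powSub])) f
    (fun _ => trivial) α

theorem ev_mem_powSub (x : Fin r → R) (n m : ℕ) (f : PolyChain r M)
    (hf : ∀ α, f α ∈ powSub x M n) : ev x m f ∈ powSub x M (n + m) :=
  ev_mem x (fun j n y hy => smul_mem_powSub x M j n y hy) n m f hf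

/-- Boundaries meet the evaluation condition: at T = x, dT g becomes dx g = 0, while dx k has
coefficients in (x)M. -/
theorem IsApproxCycle.sub {x : Fin r → R} {f : PolyChain r M} (hf : IsApproxCycle x f)
    (g k : PolyChain r M) (hg : dx x g = 0) : IsApproxCycle x (f - dT R g - dx x k) where
  dx_eq := by
    rw [map_sub, map_sub, hf.dx_eq, dx_dx, ← neg_eq_iff_eq_neg.mpr (dT_dx x g), hg]
    simp
  dT_eq := by
    obtain ⟨h, hh⟩ := hf.dT_eq
    exact ⟨h + dT R k, by rw [map_sub, map_sub, hh, dT_dT, dT_dx, map_add]; abel⟩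
  ev_mem m := by
    rw [map_sub, map_sub]
    refine sub_mem (sub_mem (hf.ev_mem m) ?_) ?_
    · cases m with
      | zero => simp [ev_zero, dT_apply_of_exponents_eq_zero]
      | succ m => rw [ev_dT, hg, map_zero]; exact zero_mem _
    · rw [add_comm]
      exact ev_mem_powSub x 1 m _ (dx_mem_powSub x k)

theorem IsApproxCycle.trunc {x : Fin r → R} {f : PolyChain r M} (hf : IsApproxCycle x f)
    (n : ℕ) : IsApproxCycle x (trunc n f) where
  dx_eq := dx_trunc_eq_zero x n hf.dx_eq
  dT_eq := by
    obtain ⟨h, hh⟩ := hf.dT_eq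
    exact ⟨KoszulApprox.trunc (n + 1) h, by rw [dT_trunc, hh, dx_trunc]⟩
  ev_mem m := by
    rw [ev_trunc]
    split_ifs
    · exact hf.ev_mem m
    · exact zero_mem _

/-- Every chain which represents a cycle and has bounded support represents a boundary. -/
def IsAcyclic (x : Fin r → R) (M : Type v) [AddCommGroup M] [Module R M] : Prop :=
  ∀ (n : ℕ) (f : PolyChain r M), IsApproxCycle x f → trunc n f = f →
    ∃ g k, dx x g = 0 ∧ f = dT R g + dx x k

theorem trunc_eq_self_iff {n : ℕ} {f : PolyChain r M} :
    trunc n f = f ↔ ∀ α, n ≤ weight α → f α = 0 := by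
  rw [funext_iff]
  refine forall_congr' fun α => ?_
  simp only [trunc]
  split_ifs with h
  · exact ⟨fun _ h' => absurd h (not_lt.mpr h'), fun _ => rfl⟩
  · exact ⟨fun h' _ => h'.symm, fun h' => (h' (not_lt.mp h)).symm⟩

variable {x : Fin (r + 1) → R}

/-- Setting T_0, e_0 and x_0 to zero respects both differentials and evaluation, as the omitted
contributions carry a factor T_0 or x_0. -/
theorem IsApproxCycle.mkQ_part {f : PolyChain (r + 1) M} (hf : IsApproxCycle x f) :
    IsApproxCycle (Fin.tail x) ((headSub M x).mkQ ∘ part f false 0) := by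
  have hπ : ∀ g : PolyChain r M, (headSub M x).mkQ ∘ (x 0 • g) = 0 := by
    intro g
    ext α
    simp only [Function.comp_apply, Pi.smul_apply, Pi.zero_apply]
    rw [← LinearMap.mem_ker, Submodule.ker_mkQ]
    exact mem_headSub.mpr ⟨_, rfl⟩
  have hadd : ∀ g h : PolyChain r M, (headSub M x).mkQ ∘ (g + h) =
      (headSub M x).mkQ ∘ g + (headSub M x).mkQ ∘ h := by
    intro g h
    ext α
    exact map_add _ _ _
  have hdx : ∀ g : PolyChain (r + 1) M, (headSub M x).mkQ ∘ part (dx x g) false 0 =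
      dx (Fin.tail x) ((headSub M x).mkQ ∘ part g false 0) := by
    intro g
    rw [part_dx_false, hadd, hπ, add_zero, dx_comp]
  refine ⟨?_, ?_, fun m => ?_⟩
  · rw [← hdx, hf.dx_eq]
    ext α
    exact map_zero _
  · obtain ⟨h, hh⟩ := hf.dT_eq
    refine ⟨(headSub M x).mkQ ∘ part h false 0, ?_⟩
    rw [dT_comp, ← part_dT_false_zero, hh, hdx]
  · rw [ev_comp]
    have := mkQ_mem_powSub (hf.ev_mem m)
    cases m with
    | zero => rwa [ev_succ_zero] at this
    | succ m =>
      rw [ev_succ_succ, map_add] at this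
      have h0 : (headSub M x).mkQ (x 0 • ev x m (unshift f)) = 0 := by
        rw [← LinearMap.mem_ker, Submodule.ker_mkQ]
        exact mem_headSub.mpr ⟨_, rfl⟩
      rwa [h0, add_zero] at this

theorem exists_smul_eq_of_mkQ_comp_eq_zero (f : PolyChain r M)
    (hf : (headSub M x).mkQ ∘ f = 0) : ∃ g : PolyChain r M, x 0 • g = f := by
  have : ∀ α, ∃ c, x 0 • c = f α := fun α => by
    rw [← mem_headSub, ← Submodule.ker_mkQ (headSub M x)]
    exact congrFun hf α
  choose g hg using this
  exact ⟨g, funext hg⟩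

theorem exists_mkQ_comp_eq (f : PolyChain r (M ⧸ headSub M x)) :
    ∃ g : PolyChain r M, (headSub M x).mkQ ∘ g = f := by
  choose g hg using fun α => (headSub M x).mkQ_surjective (f α)
  exact ⟨g, funext hg⟩

/-- Modulo boundaries, a cycle is divisible by the first variable up to terms involving the first
basis vector. -/
theorem IsDSequence.exists_part_sub_eq_zero (hd : IsDSequence x M)
    (ih : IsAcyclic (Fin.tail x) (M ⧸ headSub M x)) {n : ℕ} {f : PolyChain (r + 1) M}
    (hf : IsApproxCycle x f) (hn : trunc n f = f) :
    ∃ g k, dx x g = 0 ∧ part (f - dT R g - dx x k) false 0 = 0 := by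
  obtain ⟨g', k', hg', hfg⟩ := ih n _ hf.mkQ_part (trunc_eq_self_iff.mpr fun α hα => by
    rw [Function.comp_apply, part, trunc_eq_self_iff.mp hn, map_zero]
    simpa [weight_cons] using hα)
  obtain ⟨g₁, rfl⟩ := exists_mkQ_comp_eq g'
  obtain ⟨k₁, rfl⟩ := exists_mkQ_comp_eq k'
  -- The lift `g₁` is a cycle only modulo x_0 M. With x_0 g₂ = dx g₁, the chain g₁ - e_0 g₂ becomes
  -- a true cycle once dx g₂ = 0.
  obtain ⟨g₂, hg₂⟩ := exists_smul_eq_of_mkQ_comp_eq_zero (x := x) (dx (Fin.tail x) g₁)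
    (by rw [← dx_comp, hg'])
  -- The error of the lifted solution is x_0 a, which is the contribution of e_0 a to `dx`.
  obtain ⟨a, ha⟩ := exists_smul_eq_of_mkQ_comp_eq_zero (x := x)
    (part f false 0 - dT R g₁ - dx (Fin.tail x) k₁) (by
      rw [dT_comp, dx_comp] at hfg
      ext α
      have := congrFun hfg α
      simp only [Function.comp_apply, Pi.add_apply, Pi.sub_apply, map_sub, Pi.zero_apply] at this ⊢
      rw [this]
      abel)
  -- x_0 dx g₂ = dx dx g₁ = 0, and the coefficients of dx g₂ lie in (x)M, which meets 0 :_M x_0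
  -- trivially.
  have hg₂' : dx (Fin.tail x) g₂ = 0 := by
    ext α
    refine hd.eq_zero ?_ (dx_mem (P := ⊤) (Q := powSub x M 1) (Fin.tail x) (fun j m _ =>
      smul_mem_powSub x M j.succ 0 m (by simp [powSub])) g₂ (fun _ => trivial) α)
    have : x 0 • dx (Fin.tail x) g₂ = 0 := by rw [← map_smul, hg₂, dx_dx]
    exact congrFun this α
  refine ⟨glue fun b i => Nat.casesOn i (bif b then -g₂ else g₁) fun _ => 0,
    glue fun b i => Nat.casesOn i (bif b then a else k₁) fun _ => 0, part_ext fun b i => ?_, ?_⟩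
  · cases b <;> cases i <;> simp [hg₂, hg₂']
  · simp [ha]

/-- The obstruction to dividing f by T_0 is its part l along e_0 without T_0. If l = dT ν with ν
over L, then e_0 ν is a `dx`-cycle and dT(e_0 ν) = T_0 ν - e_0 l, so adding it to f removes l and
adds ν to the quotient. -/
theorem IsDSequence.exists_eq_dT_add_shift (hd : IsDSequence x M) {f : PolyChain (r + 1) M}
    (hf : IsApproxCycle x f) (hf0 : part f false 0 = 0) :
    ∃ g w, dx x g = 0 ∧ IsApproxCycle x w ∧ f = dT R g + shift w := by
  set L : Submodule R M := LinearMap.ker (LinearMap.lsmul R M (x 0)) with hL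
  have mem_L : ∀ {c : M}, c ∈ L ↔ x 0 • c = 0 := Iff.rfl
  have hL0 : ∀ {c : M}, c ∈ L → c ∈ powSub x M 1 → c = 0 := fun h h' => hd.eq_zero h h'
  have hdxL : ∀ g : PolyChain r M, (∀ α, g α ∈ L) → dx (Fin.tail x) g = 0 := fun g hg => by
    ext α
    exact (Submodule.mem_bot R).mp (dx_mem (P := L) (Q := ⊥) (Fin.tail x)
      (fun j m hm => hd.smul_eq_zero hm j.succ) g hg α)
  have htail : ∀ (g : PolyChain r M) α, dx (Fin.tail x) g α ∈ powSub x M 1 := fun g α =>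
    dx_mem (P := ⊤) (Fin.tail x) (fun j m _ =>
      smul_mem_powSub x M j.succ 0 m (by simp [powSub])) g (fun _ => trivial) α
  obtain ⟨h, hh⟩ := hf.dT_eq
  -- the component of `f` along the first basis vector and without the first variable
  set l := part f true 0 with hl
  have hlL : ∀ α, l α ∈ L := fun α => by
    have := congrArg (fun g => part g false 0) hf.dx_eq
    simp only [part_dx_false, hf0, map_zero, zero_add, part_zero] at this
    exact congrFun this α
  have hdTl : dT R l = 0 := by
    ext α
    refine hL0 (dT_mem l hlL α) ?_
    have := congrArg (fun g => part g true 0) hh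
    simp only [part_dT_true, part_dx_true, neg_inj] at this
    rw [this]
    exact htail _ α
  -- This constant is the coefficient of T_0 e_∅ in dT f = dx h, so it lies in L ∩ (x)M.
  have hl0 : l (fun _ => (false, 0)) = 0 := by
    refine hL0 (hlL _) ?_
    have := congrFun (congrArg (fun g => part g false 1) hh) fun _ => (false, 0)
    simp only [part_dT_false_succ (i := 0), Pi.add_apply, ← hl] at this
    rw [dT_apply_of_exponents_eq_zero _ _ (fun _ => rfl), zero_add] at this
    rw [this]
    exact dx_mem_powSub x h _
  obtain ⟨μ, hμL, hμ⟩ := exists_dT_eq L l hlL hdTl hl0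
  have hev : ∀ m, x 0 • ev x m (unshift f) ∈ powSub x M (m + 2) := fun m => by
    have := hf.ev_mem (m + 1)
    rwa [ev_succ_succ, hf0, map_zero, zero_add] at this
  have hev' : ∀ m, ∃ c ∈ powSub x M (m + 1), ev x m (unshift f) - c ∈ L := fun m => by
    obtain ⟨c, hc, hc'⟩ := hd.exists_smul_eq (hev m)
    exact ⟨c, hc, by rw [mem_L, smul_sub, hc', sub_self]⟩
  obtain ⟨c₀, hc₀, hc₀L⟩ := hev' 0
  -- correct `μ` so that the quotient evaluates into the right power of the ideal
  set ν : PolyChain r M := μ + Pi.single (fun _ => (false, 0))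
    (-(ev x 0 (unshift f) - c₀) - μ fun _ => (false, 0)) with hν
  have hνL : ∀ α, ν α ∈ L := fun α => by
    refine add_mem (hμL α) ?_
    rw [Pi.single_apply]
    split_ifs
    · exact sub_mem (neg_mem hc₀L) (hμL _)
    · exact zero_mem _
  have hν0 : ν (fun _ => (false, 0)) = -(ev x 0 (unshift f) - c₀) := by
    simp [hν]
  have hdTν : dT R ν = l := by
    have : dT R (Pi.single (fun _ => (false, 0)) (-(ev x 0 (unshift f) - c₀) -
        μ fun _ => (false, 0)) : PolyChain r M) = 0 := by
      ext α
      rw [dT_apply]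
      refine Finset.sum_eq_zero fun j _ => ?_
      split_ifs
      · rfl
      · rw [Pi.single_eq_of_ne, smul_zero]
        intro h
        simpa using congrFun h j
    rw [hν, map_add, hμ, this, add_zero]
  have hxν : x 0 • ν = 0 := funext hνL
  set e : PolyChain (r + 1) M := glue fun b i => Nat.casesOn i (bif b then 0 else ν) fun _ => 0
    with he
  set g : PolyChain (r + 1) M := glue fun b i => Nat.casesOn i (bif b then ν else 0) fun _ => 0
    with hg
  have hdxg : dx x g = 0 := part_ext fun b i => by
    cases b <;> cases i <;> simp [hg, hxν, hdxL ν hνL]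
  have hshift : shift (unshift f + e) = f - dT R (-g) - dx x 0 := part_ext fun b i => by
    rcases b with _ | _ <;> rcases i with _ | _ | i <;> simp [hg, he, hf0, hdTν, ← hl]
  have hgood := hf.sub (-g) 0 (by rw [map_neg, hdxg, neg_zero])
  rw [← hshift] at hgood
  refine ⟨-g, unshift f + e, by rw [map_neg, hdxg, neg_zero], ⟨?_, ?_, fun m => ?_⟩, ?_⟩
  · refine shift_injective ?_
    rw [← dx_shift, hgood.dx_eq, shift_zero]
  · obtain ⟨h', hh'⟩ := hgood.dT_eq
    refine ⟨unshift h', ?_⟩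
    rw [dx_unshift, ← hh', dT_shift, unshift_shift]
  · rw [map_add]
    cases m with
    | zero =>
      have : ev x 0 e = -(ev x 0 (unshift f) - c₀) := by
        rw [ev_succ_zero, ev_zero, ← hν0]
        simp [he]
      rw [this]
      simpa using hc₀
    | succ m =>
      have h1 : ev x (m + 1) e = 0 := by
        have hu : unshift e = 0 := part_ext fun b i => by simp [he]
        rw [ev_succ_succ, hu, map_zero, smul_zero, add_zero]
        have hp : part e false 0 = ν := by simp [he]
        rw [hp]
        -- The coefficients of ν are killed by every x_j, so ν evaluates to zero in positive
        -- degrees.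
        exact (Submodule.mem_bot R).mp (ev_mem (P := fun n => if n = 0 then L else ⊥) (Fin.tail x)
          (fun j n y hy => by
            by_cases hn : n = 0
            · rw [if_pos hn] at hy
              rw [if_neg n.succ_ne_zero]
              exact hd.smul_eq_zero hy j.succ
            · rw [if_neg hn, Submodule.mem_bot] at hy
              rw [hy, smul_zero]
              exact zero_mem _) 0 (m + 1) ν (by simpa using hνL))
      rw [h1, add_zero]
      obtain ⟨c, hc, hcL⟩ := hev' (m + 1)
      have h2 : ev x (m + 1) (unshift f) ∈ powSub x M (m + 1) := by
        have := ev_mem_powSub x 0 (m + 1) (unshift f) (by simp [powSub])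
        rwa [zero_add] at this
      -- In positive degrees both terms of the difference lie in (x)M, so it is in L ∩ (x)M = 0;
      -- only degree 0 needed the correction of ν.
      have h3 := hL0 hcL (sub_mem (powSub_anti (by omega) h2) (powSub_anti (by omega) hc))
      rw [sub_eq_zero.mp h3]
      exact hc
  · rw [hshift, map_zero]
    abel

theorem isAcyclic_of_isDSequence : ∀ {r : ℕ} (x : Fin r → R) (M : Type v) [AddCommGroup M]
    [Module R M], IsDSequence x M → IsAcyclic x M
  | 0, x, M, _, _, _ => by
    intro n f hf _
    refine ⟨0, 0, map_zero _, ?_⟩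
    have := hf.ev_mem 0
    rw [ev_zero] at this
    ext α
    rw [Subsingleton.elim α fun _ => (false, 0)]
    simpa [powSub] using this
  | r + 1, x, M, _, _, hd => by
    intro n
    induction n with
    | zero =>
      intro f _ hn
      exact ⟨0, 0, map_zero _, by rw [← hn, trunc_zero, map_zero, map_zero, add_zero]⟩
    | succ n ihn =>
      intro f hf hn
      obtain ⟨g₁, k₁, hg₁, hfg⟩ := hd.exists_part_sub_eq_zero
        (isAcyclic_of_isDSequence _ _ hd.tail) hf hn
      obtain ⟨g₂, w, hg₂, hw, hfw⟩ := hd.exists_eq_dT_add_shift (hf.sub g₁ k₁ hg₁) hfg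
      -- The chains found so far may be unbounded. Truncating the resulting formula for f at n + 1
      -- truncates w at n, as multiplication by T_0 raises the weight by one.
      obtain ⟨g₃, k₃, hg₃, hwg⟩ := ihn (trunc n w) (hw.trunc n)
        (trunc_eq_self_iff.mpr fun α hα => by simp [trunc, not_lt.mpr hα])
      refine ⟨trunc (n + 1) (g₁ + g₂) + shift g₃, trunc (n + 2) k₁ + shift k₃, ?_, ?_⟩
      · rw [map_add, dx_shift, hg₃, shift_zero, dx_trunc_eq_zero, add_zero]
        rw [map_add, hg₁, hg₂, add_zero]
      · rw [map_add, map_add, dT_trunc, dx_trunc, dx_shift, dT_shift]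
        have h1 : f = dT R (g₁ + g₂) + dx x k₁ + shift w := by
          rw [map_add, ← sub_eq_zero]
          rw [← sub_eq_zero] at hfw
          rw [← hfw]
          abel
        calc f = trunc (n + 1) (dT R (g₁ + g₂)) + trunc (n + 1) (dx x k₁) +
              shift (trunc n w) := by rw [← trunc_shift, ← trunc_add, ← trunc_add, ← h1, hn]
          _ = _ := by
            rw [hwg, shift_add]
            abel

/-- A `PolyChain` may involve infinitely many monomials; a bound on g is what makes it define an
element of S ⊗ H. -/
theorem IsDSequence.exists_bounded {r : ℕ} {x : Fin r → R} (hd : IsDSequence x M) {n : ℕ}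
    {f : PolyChain r M} (hf : IsApproxCycle x f) (hn : trunc n f = f) :
    ∃ g k, dx x g = 0 ∧ f = dT R g + dx x k ∧ trunc n g = g := by
  obtain ⟨g, k, hg, hfg⟩ := isAcyclic_of_isDSequence x M hd n f hf hn
  refine ⟨trunc n g, trunc (n + 1) k, dx_trunc_eq_zero x n hg, ?_,
    trunc_eq_self_iff.mpr fun α hα => by simp [trunc, not_lt.mpr hα]⟩
  rw [dT_trunc, dx_trunc, ← trunc_add, ← hfg, hn]

end Acyclic

/-! ### Coefficients of elements of `S ⊗ N` -/

section Coeff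

variable {R : Type u} [CommRing R] {r : ℕ} {N : Type v} [AddCommGroup N] [Module R N]

variable (R r N) in
/-- The coefficients of the elements of `S ⊗ N` with respect to the monomials. -/
noncomputable def coeffEquiv : S R r ⊗[R] N ≃ₗ[R] (Fin r →₀ ℕ) →₀ N :=
  TensorProduct.equivFinsuppOfBasisLeft (MvPolynomial.basisMonomials (Fin r) R)

theorem coeffEquiv_tmul (s : S R r) (a : N) (e : Fin r →₀ ℕ) :
    coeffEquiv R r N (s ⊗ₜ a) e = MvPolynomial.coeff e s • a := by
  rw [coeffEquiv, TensorProduct.equivFinsuppOfBasisLeft_apply_tmul_apply]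
  rfl

theorem coeffEquiv_symm_apply (c : (Fin r →₀ ℕ) →₀ N) :
    (coeffEquiv R r N).symm c = c.sum fun e a => MvPolynomial.monomial e (1 : R) ⊗ₜ[R] a := by
  rw [coeffEquiv, TensorProduct.equivFinsuppOfBasisLeft_symm_apply]
  simp

theorem eq_sum_coeffEquiv (z : S R r ⊗[R] N) :
    z = (coeffEquiv R r N z).sum fun e a => MvPolynomial.monomial e (1 : R) ⊗ₜ[R] a := by
  rw [← coeffEquiv_symm_apply, LinearEquiv.symm_apply_apply]

theorem coeffEquiv_X_smul (j : Fin r) (z : S R r ⊗[R] N) (e : Fin r →₀ ℕ) :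
    coeffEquiv R r N ((MvPolynomial.X j : S R r) • z) e =
      if e j = 0 then 0 else coeffEquiv R r N z (e - Finsupp.single j 1) := by
  induction z using TensorProduct.induction_on with
  | zero => simp
  | add y z hy hz =>
    rw [smul_add, map_add, Finsupp.add_apply, hy, hz, map_add, Finsupp.add_apply]
    split_ifs <;> simp
  | tmul s a =>
    rw [TensorProduct.smul_tmul', coeffEquiv_tmul, coeffEquiv_tmul, smul_eq_mul,
      MvPolynomial.coeff_X_mul']
    by_cases h : e j = 0 <;> simp [h]

theorem coeffEquiv_baseChange {P : Type v} [AddCommGroup P] [Module R P] (g : N →ₗ[R] P)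
    (z : S R r ⊗[R] N) (e : Fin r →₀ ℕ) :
    coeffEquiv R r P (g.baseChange (S R r) z) e = g (coeffEquiv R r N z e) := by
  induction z using TensorProduct.induction_on with
  | zero => simp
  | add y z hy hz => simp only [map_add, Finsupp.add_apply, hy, hz]
  | tmul s a => simp [coeffEquiv_tmul]

variable (I : Ideal R)

theorem baseChange_mem_gamma (z : S R r ⊗[R] gamma I R N) :
    (gamma I R N).subtype.baseChange (S R r) z ∈ gamma I (S R r) (S R r ⊗[R] N) := by
  induction z using TensorProduct.induction_on with
  | zero => simp
  | add y z hy hz => rw [map_add]; exact add_mem hy hz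
  | tmul s a =>
    obtain ⟨k, hk⟩ := a.2
    refine ⟨k, fun c hc => ?_⟩
    rw [LinearMap.baseChange_tmul, ← TensorProduct.tmul_smul]
    simp [hk c hc]

/-- S is free on the monomials, and a power of I killing z kills each of its coefficients. -/
theorem range_gamma_baseChange :
    LinearMap.range ((gamma I R N).subtype.baseChange (S R r)) =
      gamma I (S R r) (S R r ⊗[R] N) := by
  refine le_antisymm (LinearMap.range_le_iff_comap.mpr <| eq_top_iff.mpr fun z _ =>
    baseChange_mem_gamma I z) ?_
  rintro z ⟨k, hk⟩
  rw [eq_sum_coeffEquiv z]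
  refine Submodule.sum_mem _ fun e _ => ⟨MvPolynomial.monomial e 1 ⊗ₜ
    ⟨coeffEquiv R r N z e, k, fun c hc => ?_⟩, rfl⟩
  rw [← Finsupp.smul_apply, ← map_smul, hk c hc, map_zero, Finsupp.zero_apply]

theorem gamma_baseChange_injective :
    Function.Injective ((gamma I R N).subtype.baseChange (S R r)) :=
  Module.Flat.lTensor_preserves_injective_linearMap (M := S R r) (gamma I R N).subtype
    Subtype.val_injective

end Coeff

/-! ### Gradings -/

section Grading

variable {R : Type u} [CommRing R] {r : ℕ}

theorem isInternal_of_projections {A : Type v} [AddCommGroup A] [Module R A]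
    (𝒜 : ℕ → Submodule R A) (π : ℕ → A →ₗ[R] A) (h₁ : ∀ n, ∀ z ∈ 𝒜 n, π n z = z)
    (h₂ : ∀ m n, m ≠ n → ∀ z ∈ 𝒜 m, π n z = 0) (h₃ : ∀ z, z ∈ ⨆ n, 𝒜 n) :
    DirectSum.IsInternal 𝒜 := by
  refine DirectSum.isInternal_submodule_of_iSupIndep_of_iSup_eq_top ?_
    (eq_top_iff.mpr fun z _ => h₃ z)
  intro n
  rw [Submodule.disjoint_def]
  intro z hz hz'
  rw [← h₁ n z hz]
  have : ⨆ m, ⨆ (_ : m ≠ n), 𝒜 m ≤ LinearMap.ker (π n) :=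
    iSup₂_le fun m hm z hz => h₂ m n hm z hz
  exact this hz'

variable {N : Type v} [AddCommGroup N] [Module R N]

theorem tmul_mem_tensorDeg {s : S R r} {m : ℕ}
    (hs : s ∈ MvPolynomial.homogeneousSubmodule (Fin r) R m) (a : N) {k n : ℕ} (h : m + k = n) :
    s ⊗ₜ[R] a ∈ tensorDeg r N k n :=
  Submodule.subset_span ⟨m, s, a, hs, h, rfl⟩

theorem isGradedModule_tensorDeg (k : ℕ) : IsGradedModule r (tensorDeg (R := R) r N k) := by
  -- Without the guard, truncated subtraction would give the degree 0 component for every n < k.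
  refine ⟨isInternal_of_projections _ (fun n => if k ≤ n then
    (MvPolynomial.homogeneousComponent (n - k)).rTensor N else 0) ?_ ?_ ?_, ?_⟩
  · intro n z hz
    induction hz using Submodule.span_induction with
    | mem z hz =>
      obtain ⟨m, s, a, hs, rfl, rfl⟩ := hz
      rw [if_pos (Nat.le_add_left k m), LinearMap.rTensor_tmul, Nat.add_sub_cancel,
        MvPolynomial.homogeneousComponent_of_mem hs, if_pos rfl]
    | zero => exact map_zero _
    | add y z _ _ hy hz => rw [map_add, hy, hz]
    | smul c z _ hz => rw [map_smul, hz]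
  · intro m n hmn z hz
    induction hz using Submodule.span_induction with
    | mem z hz =>
      obtain ⟨m, s, a, hs, rfl, rfl⟩ := hz
      split_ifs with h
      · rw [LinearMap.rTensor_tmul, MvPolynomial.homogeneousComponent_of_mem hs,
          if_neg (by omega), TensorProduct.zero_tmul]
      · rfl
    | zero => exact map_zero _
    | add y z _ _ hy hz => rw [map_add, hy, hz, add_zero]
    | smul c z _ hz => rw [map_smul, hz, smul_zero]
  · intro z
    induction z using TensorProduct.induction_on with
    | zero => exact zero_mem _
    | add y z hy hz => exact add_mem hy hz
    | tmul s a =>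
      rw [← MvPolynomial.sum_homogeneousComponent s, TensorProduct.sum_tmul]
      exact Submodule.sum_mem _ fun i _ => Submodule.mem_iSup_of_mem (i + k)
        (tmul_mem_tensorDeg (MvPolynomial.homogeneousComponent_mem i s) a rfl)
  · intro a b s z hs hz
    induction hz using Submodule.span_induction with
    | mem z hz =>
      obtain ⟨m, t, c, ht, rfl, rfl⟩ := hz
      rw [TensorProduct.smul_tmul', smul_eq_mul]
      refine tmul_mem_tensorDeg (m := a + m) ?_ c (by omega)
      rw [MvPolynomial.mem_homogeneousSubmodule] at *
      exact hs.mul ht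
    | zero => rw [smul_zero]; exact zero_mem _
    | add y z _ _ hy hz => rw [smul_add]; exact add_mem hy hz
    | smul c z _ hz => rw [smul_comm]; exact Submodule.smul_mem _ _ hz

/-- A map `∑ⱼ Tⱼ ⊗ gⱼ` is homogeneous of degree `0` from `S[-(k+1)] ⊗ N` to `S[-k] ⊗ P`. -/
theorem isGradedMap_sum_X_smul {P : Type v} [AddCommGroup P] [Module R P]
    (g : Fin r → N →ₗ[R] P) (k : ℕ) :
    IsGradedMap (tensorDeg r N (k + 1)) (tensorDeg r P k)
      (∑ j, (MvPolynomial.X j : S R r) • (g j).baseChange (S R r)) := by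
  intro n z hz
  induction hz using Submodule.span_induction with
  | mem z hz =>
    obtain ⟨m, s, a, hs, rfl, rfl⟩ := hz
    rw [LinearMap.sum_apply]
    refine Submodule.sum_mem _ fun j _ => ?_
    rw [LinearMap.smul_apply, LinearMap.baseChange_tmul, TensorProduct.smul_tmul', smul_eq_mul]
    refine tmul_mem_tensorDeg (m := 1 + m) ?_ _ (by omega)
    rw [MvPolynomial.mem_homogeneousSubmodule] at *
    exact (MvPolynomial.isHomogeneous_X R j).mul hs
  | zero => rw [map_zero]; exact zero_mem _
  | add y z _ _ hy hz => rw [map_add]; exact add_mem hy hz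
  | smul c z _ hz =>
    rw [← algebraMap_smul (S R r) c z, map_smul, algebraMap_smul]
    exact Submodule.smul_mem _ _ hz

/-! ### The grading of gr_{(x)}(M) and of its torsion -/

variable (x : Fin r → R) (M : Type v) [AddCommGroup M] [Module R M]

theorem X_smul_grOf (j : Fin r) (n : ℕ) (m : powSub x M n) :
    (MvPolynomial.X j : S R r) • grOf x M n (Submodule.Quotient.mk m) =
      grOf x M (n + 1) (Submodule.Quotient.mk ⟨x j • m.1, smul_mem_powSub x M j n m.1 m.2⟩) := by
  rw [gr_smul_def, grAction_X, grMul_grOf]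

/-- `z` is the class of `m` in the component `(x)^n M / (x)^{n+1} M` of `gr_{(x)}(M)`. -/
def IsClass (n : ℕ) (m : M) (z : Gr x M) : Prop :=
  ∃ h : m ∈ powSub x M n, z = grOf x M n (Submodule.Quotient.mk ⟨m, h⟩)

variable {x M}

theorem exists_isClass {n : ℕ} {z : Gr x M} (hz : z ∈ grDeg x M n) : ∃ m, IsClass x M n m z := by
  obtain ⟨y, rfl⟩ := hz
  obtain ⟨m, rfl⟩ := Submodule.Quotient.mk_surjective _ y
  exact ⟨m.1, m.2, rfl⟩

theorem IsClass.mem_grDeg {n : ℕ} {m : M} {z : Gr x M} (h : IsClass x M n m z) :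
    z ∈ grDeg x M n := by
  obtain ⟨hm, rfl⟩ := h
  exact ⟨_, rfl⟩

theorem IsClass.X_smul {n : ℕ} {m : M} {z : Gr x M} (h : IsClass x M n m z) (j : Fin r) :
    IsClass x M (n + 1) (x j • m) ((MvPolynomial.X j : S R r) • z) := by
  obtain ⟨hm, rfl⟩ := h
  exact ⟨_, X_smul_grOf x M j n _⟩

theorem IsClass.smul {n : ℕ} {m : M} {z : Gr x M} (h : IsClass x M n m z) (c : R) :
    IsClass x M n (c • m) (c • z) := by
  obtain ⟨hm, rfl⟩ := h
  exact ⟨Submodule.smul_mem _ c hm, (map_smul (grOf x M n) c _).symm⟩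

theorem IsClass.monomial_smul {n : ℕ} {m : M} {z : Gr x M} (h : IsClass x M n m z)
    (e : Fin r →₀ ℕ) : IsClass x M (e.degree + n) ((∏ i, x i ^ e i) • m)
      (MvPolynomial.monomial e (1 : R) • z) := by
  induction e using Finsupp.induction_linear generalizing n m z with
  | zero => simpa using h
  | add e f he hf =>
    have := he (hf h)
    rw [← mul_smul, ← mul_smul, MvPolynomial.monomial_mul, ← Finset.prod_mul_distrib, one_mul,
      ← add_assoc] at this
    simpa [pow_add] using this
  | single j k =>
    have hp : ∏ i, x i ^ Finsupp.single j k i = x j ^ k := by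
      rw [Finset.prod_eq_single j (fun i _ hi => by simp [Finsupp.single_eq_of_ne hi]) (by simp)]
      simp
    rw [hp, Finsupp.degree_single, ← MvPolynomial.X_pow_eq_monomial]
    clear hp
    induction k with
    | zero => simpa using h
    | succ k ih =>
      rw [pow_succ', pow_succ', mul_smul, mul_smul, add_right_comm]
      exact ih.X_smul j

variable (x M)

theorem smul_mem_grDeg {a : ℕ} {s : S R r}
    (hs : s ∈ MvPolynomial.homogeneousSubmodule (Fin r) R a) {b : ℕ} {z : Gr x M}
    (hz : z ∈ grDeg x M b) : s • z ∈ grDeg x M (a + b) := by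
  rw [s.as_sum, Finset.sum_smul]
  refine Submodule.sum_mem _ fun e he => ?_
  have h : e.degree = a := by
    rw [MvPolynomial.mem_homogeneousSubmodule] at hs
    rw [Finsupp.degree_eq_weight_one]
    exact hs (MvPolynomial.mem_support_iff.mp he)
  obtain ⟨m, hm⟩ := exists_isClass hz
  rw [← h, ← mul_one (MvPolynomial.coeff e s), ← smul_eq_mul, ← MvPolynomial.smul_monomial,
    smul_assoc]
  exact ((hm.monomial_smul e).smul _).mem_grDeg

/-- The homogeneous components of the elements of `gr_{(x)}(M)`. -/
noncomputable def grComponent (n : ℕ) : Gr x M →ₗ[R]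
    (powSub x M n) ⧸ (powSub x M (n + 1)).submoduleOf (powSub x M n) :=
  DirectSum.component R ℕ
    (fun n => (powSub x M n) ⧸ (powSub x M (n + 1)).submoduleOf (powSub x M n)) n

theorem grComponent_grOf_self (n : ℕ)
    (y : (powSub x M n) ⧸ (powSub x M (n + 1)).submoduleOf (powSub x M n)) :
    grComponent x M n (grOf x M n y) = y :=
  DirectSum.component.lof_self R _ _

theorem grComponent_grOf_of_ne {m n : ℕ} (h : m ≠ n)
    (y : (powSub x M m) ⧸ (powSub x M (m + 1)).submoduleOf (powSub x M m)) :
    grComponent x M n (grOf x M m y) = 0 :=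
  (DirectSum.component.of R _ _ _).trans (dif_neg h)

theorem eq_sum_grComponent (z : Gr x M) :
    ∃ t : Finset ℕ, z = ∑ n ∈ t, grOf x M n (grComponent x M n z) := by
  classical
  exact ⟨_, (DirectSum.sum_support_of z).symm⟩

theorem isGradedModule_gammaGrDeg (I : Ideal R) : IsGradedModule r (gammaGrDeg x M I) := by
  have hmem : ∀ n, ∀ z ∈ gamma I (S R r) (Gr x M),
      grOf x M n (grComponent x M n z) ∈ gamma I (S R r) (Gr x M) := by
    rintro n z ⟨k, hk⟩
    exact ⟨k, fun a ha => by rw [← map_smul, ← map_smul, hk a ha, map_zero, map_zero]⟩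
  let π (n : ℕ) : gamma I (S R r) (Gr x M) →ₗ[R] gamma I (S R r) (Gr x M) :=
    { toFun := fun z => ⟨grOf x M n (grComponent x M n z.1), hmem n z.1 z.2⟩
      map_add' := fun y z => Subtype.ext (by simp)
      map_smul' := fun c z => Subtype.ext (by simp) }
  refine ⟨isInternal_of_projections _ π ?_ ?_ ?_, fun a b s z hs hz => smul_mem_grDeg x M hs hz⟩
  · rintro n ⟨z, hz⟩ ⟨y, rfl⟩
    refine Subtype.ext ?_
    simp [π, grComponent_grOf_self]
  · rintro m n hmn ⟨z, hz⟩ ⟨y, rfl⟩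
    refine Subtype.ext ?_
    simp [π, grComponent_grOf_of_ne x M hmn]
  · rintro ⟨z, hz⟩
    obtain ⟨t, ht⟩ := eq_sum_grComponent x M z
    have : (⟨z, hz⟩ : gamma I (S R r) (Gr x M)) = ∑ n ∈ t, π n ⟨z, hz⟩ := by
      refine Subtype.ext ?_
      rw [AddSubmonoidClass.coe_finsetSum]
      exact ht
    rw [this]
    exact Submodule.sum_mem _ fun n _ => Submodule.mem_iSup_of_mem n ⟨_, rfl⟩

end Grading

/-! ### The complexes -/

section Complexes

variable {R : Type u} [CommRing R] {r : ℕ} (x : Fin r → R) (M : Type v) [AddCommGroup M]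
  [Module R M] (I : Ideal R)

theorem subsingleton_koszulH {p : ℕ} (hp : r < p) : Subsingleton (KoszulH x M p) := by
  have : IsEmpty {s : Finset (Fin r) // s.card = p} :=
    ⟨fun s => absurd (s.2 ▸ card_finset_fin_le s.1) (not_le.mpr hp)⟩
  exact (Submodule.Quotient.mk_surjective _).subsingleton

theorem subsingleton_tensorProduct {N : Type v} [AddCommGroup N] [Module R N] [Subsingleton N] :
    Subsingleton (S R r ⊗[R] N) :=
  (coeffEquiv R r N).toEquiv.subsingleton

theorem approxD_tmul (p : ℕ) (s : S R r) (a : KoszulH x M (p + 1)) :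
    approxD x M p (s ⊗ₜ a) = ∑ j, (MvPolynomial.X j * s) ⊗ₜ contractH x M p j a := by
  simp [approxD, TensorProduct.smul_tmul']

theorem contractH_contractH (p : ℕ) (i j : Fin r) (a : KoszulH x M (p + 2)) :
    contractH x M p i (contractH x M (p + 1) j a) =
      -contractH x M p j (contractH x M (p + 1) i a) := by
  obtain ⟨f, rfl⟩ := Submodule.Quotient.mk_surjective _ a
  refine congrArg Submodule.Quotient.mk (Subtype.ext ?_)
  exact contract_contract M p i j f.1

theorem contractH_self (p : ℕ) (i : Fin r) (a : KoszulH x M (p + 2)) :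
    contractH x M p i (contractH x M (p + 1) i a) = 0 := by
  obtain ⟨f, rfl⟩ := Submodule.Quotient.mk_surjective _ a
  refine (congrArg Submodule.Quotient.mk (Subtype.ext ?_)).trans (Submodule.Quotient.mk_zero _)
  ext s
  by_cases h : i ∈ s.1 <;> simp [contract, h]

/-- The variables commute and the contractions anticommute, so the terms (i, j) and (j, i) cancel;
the diagonal terms vanish separately, as 2 may be a zero divisor. -/
theorem approxD_comp_approxD (p : ℕ) : approxD x M p ∘ₗ approxD x M (p + 1) = 0 := by
  refine TensorProduct.AlgebraTensorModule.ext fun s a => ?_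
  simp only [LinearMap.comp_apply, approxD_tmul, map_sum, LinearMap.zero_apply]
  rw [← Finset.sum_product']
  refine Finset.sum_involution (fun a _ => (a.2, a.1)) ?_ ?_ (by simp) (by simp)
  · rintro ⟨i, j⟩ -
    simp only
    rw [contractH_contractH x M p i j, TensorProduct.tmul_neg, mul_left_comm, add_neg_cancel]
  · rintro ⟨i, j⟩ - hne heq
    simp only [Prod.mk.injEq] at heq
    obtain ⟨rfl, -⟩ := heq
    exact hne (by simp [contractH_self])

theorem approxAug_tmul (s : S R r) (a : KoszulH x M 0) :
    approxAug x M (s ⊗ₜ a) = s • koszulHZeroToGr x M a := by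
  simp [approxAug]

theorem koszulHZeroToGr_mk (f : cycles x M 0) :
    koszulHZeroToGr x M (Submodule.Quotient.mk f) =
      grOf x M 0 (Submodule.Quotient.mk ⟨f.1 ⟨∅, rfl⟩, by simp [powSub]⟩) := rfl

theorem approxAug_comp_approxD : approxAug x M ∘ₗ approxD x M 0 = 0 := by
  refine TensorProduct.AlgebraTensorModule.ext fun s a => ?_
  obtain ⟨f, rfl⟩ := Submodule.Quotient.mk_surjective _ a
  simp only [LinearMap.comp_apply, approxD_tmul, map_sum, LinearMap.zero_apply, approxAug_tmul,
    mul_comm _ s, mul_smul]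
  rw [← Finset.smul_sum]
  have h : ∀ j, (MvPolynomial.X j : S R r) •
      koszulHZeroToGr x M (contractH x M 0 j (Submodule.Quotient.mk f)) =
      (grOf x M 1 ∘ₗ Submodule.mkQ _) ⟨x j • contract R M 0 j f.1 ⟨∅, rfl⟩,
        smul_mem_powSub x M j 0 _ (by simp [powSub])⟩ := fun j =>
    X_smul_grOf x M j 0 _
  have h0 : koszulD x M 0 f.1 = 0 := f.2
  simp only [h, ← map_sum]
  convert smul_zero s
  refine (congrArg _ (Subtype.ext ?_)).trans (map_zero _)
  rw [AddSubmonoidClass.coe_finsetSum]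
  simpa [koszulD, Finset.sum_apply] using congrFun h0 ⟨∅, rfl⟩

theorem gammaIncl_comp_gammaD (p : ℕ) :
    gammaIncl x M I p ∘ₗ gammaD x M I p = approxD x M p ∘ₗ gammaIncl x M I (p + 1) := by
  refine TensorProduct.AlgebraTensorModule.ext fun s a => ?_
  simp [gammaIncl, gammaD, approxD, gammaMap]

theorem subtype_comp_gammaAug :
    (gamma I (S R r) (Gr x M)).subtype ∘ₗ gammaAug x M I = approxAug x M ∘ₗ gammaIncl x M I 0 :=
  rfl

theorem gammaD_comp_gammaD (p : ℕ) : gammaD x M I p ∘ₗ gammaD x M I (p + 1) = 0 := by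
  refine LinearMap.ext fun z => gamma_baseChange_injective I ?_
  have h₁ := fun y => LinearMap.congr_fun (gammaIncl_comp_gammaD x M I p) y
  have h₂ := fun y => LinearMap.congr_fun (gammaIncl_comp_gammaD x M I (p + 1)) y
  have h₃ := fun y => LinearMap.congr_fun (approxD_comp_approxD x M p) y
  simp only [LinearMap.comp_apply, LinearMap.zero_apply] at h₁ h₂ h₃ ⊢
  change gammaIncl x M I p _ = gammaIncl x M I p 0
  rw [h₁, h₂, h₃, map_zero]

theorem gammaAug_comp_gammaD : gammaAug x M I ∘ₗ gammaD x M I 0 = 0 := by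
  refine LinearMap.ext fun z => Subtype.ext ?_
  have h₁ := LinearMap.congr_fun (gammaIncl_comp_gammaD x M I 0) z
  have h₂ := LinearMap.congr_fun (approxAug_comp_approxD x M) (gammaIncl x M I 1 z)
  change approxAug x M (gammaIncl x M I 0 (gammaD x M I 0 z)) = 0
  rw [LinearMap.comp_apply] at h₁
  rw [h₁]
  exact h₂

theorem isGradedMap_gammaAug :
    IsGradedMap (gammaDeg x M I 0) (gammaGrDeg x M I) (gammaAug x M I) := by
  intro n z hz
  change approxAug x M (gammaIncl x M I 0 z) ∈ grDeg x M n
  induction hz using Submodule.span_induction with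
  | mem z hz =>
    obtain ⟨m, s, a, hs, rfl, rfl⟩ := hz
    rw [gammaIncl, LinearMap.baseChange_tmul, approxAug_tmul]
    exact smul_mem_grDeg x M hs ⟨_, rfl⟩
  | zero => rw [map_zero, map_zero]; exact zero_mem _
  | add y z _ _ hy hz => rw [map_add, map_add]; exact add_mem hy hz
  | smul c z _ hz =>
    rw [← algebraMap_smul (S R r) c z, map_smul, map_smul, algebraMap_smul]
    exact Submodule.smul_mem _ _ hz

/-- gr is generated over S in degree 0, because (x)^{n+1} M = (x)(x)^n M. -/
theorem approxAug_surjective : Function.Surjective (approxAug x M) := by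
  have hX : ∀ j, ∀ z ∈ LinearMap.range (approxAug x M),
      (MvPolynomial.X j : S R r) • z ∈ LinearMap.range (approxAug x M) :=
    fun j z hz => Submodule.smul_mem _ _ hz
  have key : ∀ n m (h : m ∈ powSub x M n), grOf x M n (Submodule.Quotient.mk ⟨m, h⟩) ∈
      (LinearMap.range (approxAug x M)).restrictScalars R := by
    intro n
    induction n with
    | zero =>
      intro m h
      refine ⟨1 ⊗ₜ Submodule.Quotient.mk ⟨fun _ => m, trivial⟩, ?_⟩
      rw [approxAug_tmul, one_smul, koszulHZeroToGr_mk]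
    | succ n ih =>
      let Q : Submodule R (powSub x M (n + 1)) :=
        ((LinearMap.range (approxAug x M)).restrictScalars R).comap
          (grOf x M (n + 1) ∘ₗ Submodule.mkQ _)
      suffices h : powSub x M (n + 1) ≤ Q.map (powSub x M (n + 1)).subtype by
        intro m hm
        obtain ⟨y, hy, rfl⟩ := h hm
        exact hy
      refine (powSub_succ n).le.trans ?_
      rw [← Submodule.span_eq (powSub x M n), Ideal.span, Submodule.span_smul_span,
        Submodule.span_le]
      rintro _ ⟨_, ⟨j, rfl⟩, m, hm, rfl⟩
      refine ⟨⟨x j • m, smul_mem_powSub x M j n m hm⟩, ?_, rfl⟩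
      change grOf x M (n + 1) (Submodule.Quotient.mk _) ∈ LinearMap.range (approxAug x M)
      have := hX j _ (ih m hm)
      rwa [X_smul_grOf] at this
  intro z
  obtain ⟨t, ht⟩ := eq_sum_grComponent x M z
  rw [← LinearMap.mem_range, ht]
  refine Submodule.sum_mem _ fun n _ => ?_
  obtain ⟨m, hm⟩ := Submodule.Quotient.mk_surjective _ (grComponent x M n z)
  rw [← hm]
  exact key n m.1 m.2

end Complexes

/-! ### Chains with polynomial coefficients and the approximation complex -/

section Translation

variable {R : Type u} [CommRing R] {r : ℕ} {M : Type v} [AddCommGroup M] [Module R M]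

/-- The component of degree `p` of a chain with polynomial coefficients. -/
def comp (p : ℕ) (f : PolyChain r M) (e : Fin r →₀ ℕ) : Chain r p M :=
  fun s => f fun i => (decide (i ∈ s.1), e i)

/-- The chain with polynomial coefficients which is concentrated in degree `p`. -/
noncomputable def ofComp (p : ℕ) (c : (Fin r →₀ ℕ) → Chain r p M) : PolyChain r M := fun α =>
  if h : (Finset.univ.filter fun i => (α i).1 = true).card = p then
    c (Finsupp.equivFunOnFinite.symm fun i => (α i).2) ⟨_, h⟩ else 0

theorem comp_ofComp (p : ℕ) (c : (Fin r →₀ ℕ) → Chain r p M) : comp p (ofComp p c) = c := by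
  ext e s
  have hs : (Finset.univ.filter fun i => decide (i ∈ s.1) = true) = s.1 := by ext; simp
  have he : (Finsupp.equivFunOnFinite.symm fun i => e i) = e := by ext; simp
  simp only [comp, ofComp, hs, s.2, dite_true, he]

theorem comp_ofComp_of_ne {p q : ℕ} (h : q ≠ p) (c : (Fin r →₀ ℕ) → Chain r p M)
    (e : Fin r →₀ ℕ) : comp q (ofComp p c) e = 0 := by
  ext s
  have hs : (Finset.univ.filter fun i => decide (i ∈ s.1) = true) = s.1 := by ext; simp
  simp only [comp, ofComp, hs, s.2, h, dite_false, Pi.zero_apply]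

theorem comp_ext {f g : PolyChain r M} (h : ∀ p e, comp p f e = comp p g e) : f = g := by
  ext α
  have := congrFun (h _ (Finsupp.equivFunOnFinite.symm fun i => (α i).2))
    ⟨Finset.univ.filter fun i => (α i).1 = true, rfl⟩
  simpa [comp] using this

theorem comp_zero (p : ℕ) (e : Fin r →₀ ℕ) : comp p (0 : PolyChain r M) e = 0 := rfl

theorem sgn_decide (s : Finset (Fin r)) (e : Fin r → ℕ) (j : Fin r) :
    sgn R (fun i => (decide (i ∈ s), e i)) j = (-1) ^ (s.filter (· < j)).card := by
  have : (Finset.univ.filter fun i => i < j ∧ decide (i ∈ s) = true) = s.filter (· < j) := by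
    ext i
    simp [and_comm]
  rw [sgn, Finset.prod_ite, Finset.prod_const, Finset.prod_const, one_pow, mul_one, this]

theorem update_decide (s : Finset (Fin r)) (e : Fin r → ℕ) (j : Fin r) (k : ℕ) :
    Function.update (fun i => (decide (i ∈ s), e i)) j (true, k) =
      fun i => (decide (i ∈ insert j s), Function.update e j k i) := by
  ext i : 1
  by_cases h : i = j
  · subst h; simp
  · simp [h]

theorem comp_dx (x : Fin r → R) (p : ℕ) (f : PolyChain r M) (e : Fin r →₀ ℕ) :
    comp p (dx x f) e = koszulD x M p (comp (p + 1) f e) := by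
  ext s
  simp only [comp, dx_apply, koszulD, LinearMap.sum_apply, Finset.sum_apply, LinearMap.smul_apply,
    Pi.smul_apply, contract, LinearMap.coe_mk, AddHom.coe_mk, decide_eq_true_eq, sgn_decide,
    update_decide, Function.update_eq_self]
  refine Finset.sum_congr rfl fun j _ => ?_
  split_ifs
  · rw [smul_zero]
  · rw [smul_comm]

theorem comp_dT (p : ℕ) (f : PolyChain r M) (e : Fin r →₀ ℕ) :
    comp p (dT R f) e = ∑ j, if e j = 0 then 0 else
      contract R M p j (comp (p + 1) f (e - Finsupp.single j 1)) := by
  ext s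
  simp only [comp, dT_apply, Finset.sum_apply, contract, decide_eq_true_eq, sgn_decide,
    update_decide]
  refine Finset.sum_congr rfl fun j _ => ?_
  by_cases hj : j ∈ s.1
  · by_cases he : e j = 0 <;> simp [hj, he]
  · by_cases he : e j = 0
    · simp [he]
    · have : ∀ i, Function.update e j (e j - 1) i =
        (e - Finsupp.single j 1 : Fin r →₀ ℕ) i := by
        intro i
        by_cases h : i = j
        · subst h; simp
        · simp [h, Finsupp.single_eq_of_ne h]
      simp [comp, hj, he, this]

theorem weight_decide (s : Finset (Fin r)) (e : Fin r →₀ ℕ) :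
    weight (fun i => (decide (i ∈ s), e i)) = s.card + e.degree := by
  simp only [weight, Finset.sum_add_distrib, Finsupp.degree_eq_sum]
  congr 1
  rw [Finset.card_eq_sum_ones, ← Finset.sum_filter_add_sum_filter_not Finset.univ (· ∈ s)]
  rw [Finset.sum_congr (g := fun _ => 1) rfl (by intro i hi; simp at hi; simp [hi]),
    Finset.sum_eq_zero (s := Finset.univ.filter (· ∉ s)) (by intro i hi; simp at hi; simp [hi])]
  simp

theorem exists_trunc_ofComp_eq (p : ℕ) (c : (Fin r →₀ ℕ) → Chain r p M)
    (t : Finset (Fin r →₀ ℕ)) (hc : ∀ e ∉ t, c e = 0) :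
    ∃ n, trunc n (ofComp p c) = ofComp p c := by
  refine ⟨p + t.sup Finsupp.degree + 1, trunc_eq_self_iff.mpr fun α hα => ?_⟩
  rw [ofComp]
  split_ifs with h
  · rw [hc, Pi.zero_apply]
    intro he
    have h1 := Finset.le_sup (f := Finsupp.degree) he
    have h2 : weight α = p + (Finsupp.equivFunOnFinite.symm fun i => (α i).2).degree := by
      rw [← h, ← weight_decide]
      simp
    omega
  · rfl

theorem ev_eq_zero : ∀ {r : ℕ} (x : Fin r → R) (m : ℕ) (f : PolyChain r M),
    (∀ e : Fin r → ℕ, f (fun i => (false, e i)) = 0) → ev x m f = 0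
  | 0, _, 0, _, h => by
    rw [ev_zero]
    exact h fun _ => 0
  | 0, _, m + 1, _, _ => by simp [ev]
  | r + 1, x, m, f, h => by
    rw [ev_succ]
    refine Finset.sum_eq_zero fun ij _ => ?_
    rw [ev_eq_zero _ _ _ fun e => ?_, smul_zero]
    rw [← h (Fin.cons ij.1 e), part]
    congr 1
    ext i : 1
    cases i using Fin.cases <;> rfl

/-! ### Lifting elements of S ⊗ H_p to chains, and exactness of the approximation complex -/

variable (x : Fin r → R)

theorem coeffEquiv_approxD (p : ℕ) (z : S R r ⊗[R] KoszulH x M (p + 1)) (e : Fin r →₀ ℕ) :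
    coeffEquiv R r _ (approxD x M p z) e = ∑ j, if e j = 0 then 0 else
      contractH x M p j (coeffEquiv R r _ z (e - Finsupp.single j 1)) := by
  simp only [approxD, LinearMap.sum_apply, LinearMap.smul_apply, map_sum, Finsupp.finsetSum_apply,
    coeffEquiv_X_smul, coeffEquiv_baseChange]

theorem sum_contractH_mk (p : ℕ) (c : (Fin r →₀ ℕ) → Chain r (p + 1) M)
    (hc : ∀ e, c e ∈ cycles x M (p + 1)) (e : Fin r →₀ ℕ) :
    ∃ h : (∑ j, if e j = 0 then 0 else contract R M p j (c (e - Finsupp.single j 1))) ∈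
        cycles x M p,
      (∑ j, if e j = 0 then 0 else contractH x M p j
        (Submodule.Quotient.mk ⟨c (e - Finsupp.single j 1), hc _⟩)) =
      (Submodule.Quotient.mk ⟨_, h⟩ : KoszulH x M p) := by
  have hmem : ∀ j, (if e j = 0 then 0 else contract R M p j (c (e - Finsupp.single j 1))) ∈
      cycles x M p := fun j => by
    split_ifs
    · exact zero_mem _
    · exact contract_mem_cycles x M p j _ (hc _)
  refine ⟨Submodule.sum_mem _ fun j _ => hmem j, ?_⟩
  have h2 : ∀ j, (if e j = 0 then 0 else contractH x M p j
      (Submodule.Quotient.mk ⟨c (e - Finsupp.single j 1), hc _⟩)) =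
      ((boundaries x M p).submoduleOf (cycles x M p)).mkQ ⟨_, hmem j⟩ := fun j => by
    by_cases h : e j = 0
    · simp only [h, if_true]
      exact (map_zero _).symm
    · simp only [h, if_false]
      rfl
  rw [Finset.sum_congr rfl fun j _ => h2 j, ← map_sum, Submodule.mkQ_apply]
  congr 1
  refine Subtype.ext ?_
  rw [AddSubmonoidClass.coe_finsetSum]

theorem mk_eq_mk_iff {p : ℕ} {a b : Chain r p M} (ha : a ∈ cycles x M p)
    (hb : b ∈ cycles x M p) :
    (Submodule.Quotient.mk ⟨a, ha⟩ : KoszulH x M p) = Submodule.Quotient.mk ⟨b, hb⟩ ↔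
      a - b ∈ boundaries x M p :=
  Submodule.Quotient.eq _

/-- Zero coefficients are lifted to zero, so that the lift has finite support. -/
theorem exists_lift (p : ℕ) (z : S R r ⊗[R] KoszulH x M p) :
    ∃ (c : (Fin r →₀ ℕ) → Chain r p M) (hc : ∀ e, c e ∈ cycles x M p),
      (∀ e, coeffEquiv R r _ z e = Submodule.Quotient.mk ⟨c e, hc e⟩) ∧
      ∀ e ∉ (coeffEquiv R r _ z).support, c e = 0 := by
  classical
  choose f hf using fun e => Submodule.Quotient.mk_surjective _ (coeffEquiv R r _ z e)
  refine ⟨fun e => if coeffEquiv R r _ z e = 0 then 0 else (f e).1, fun e => ?_, fun e => ?_,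
    fun e he => if_pos (Finsupp.notMem_support_iff.mp he)⟩
  · dsimp only
    split_ifs
    · exact zero_mem _
    · exact (f e).2
  · by_cases h : coeffEquiv R r _ z e = 0
    · simp only [h, if_true]
      rfl
    · simp only [h, if_false]
      exact (hf e).symm

/-- Only the component of g in chain degree p + 1 matters: its coefficients are cycles and their
classes form y. The term dx k dies in homology. -/
theorem exists_approxD_eq {p n : ℕ} {z : S R r ⊗[R] KoszulH x M p}
    {c : (Fin r →₀ ℕ) → Chain r p M} (hc : ∀ e, c e ∈ cycles x M p)
    (hz : ∀ e, coeffEquiv R r _ z e = Submodule.Quotient.mk ⟨c e, hc e⟩)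
    {g k : PolyChain r M} (hg : dx x g = 0) (hgk : ofComp p c = dT R g + dx x k)
    (hn : trunc n g = g) : ∃ y, approxD x M p y = z := by
  have hcyc : ∀ e, comp (p + 1) g e ∈ cycles x M (p + 1) := fun e => by
    change koszulD x M p _ = 0
    rw [← comp_dx, hg, comp_zero]
  let b : (Fin r →₀ ℕ) →₀ KoszulH x M (p + 1) :=
    Finsupp.onFinset (Finsupp.finite_of_degree_lt n).toFinset
      (fun e => Submodule.Quotient.mk ⟨comp (p + 1) g e, hcyc e⟩) fun e he => by
        rw [Set.Finite.mem_toFinset]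
        by_contra hlt
        refine he ?_
        have : comp (p + 1) g e = 0 := by
          ext s
          refine trunc_eq_self_iff.mp hn _ ?_
          rw [weight_decide]
          have : n ≤ e.degree := not_lt.mp hlt
          omega
        simp only [this]
        rfl
  refine ⟨(coeffEquiv R r _).symm b, (coeffEquiv R r _).injective ?_⟩
  ext e
  rw [coeffEquiv_approxD, LinearEquiv.apply_symm_apply, hz]
  obtain ⟨hs, hs'⟩ := sum_contractH_mk x p _ hcyc e
  change (∑ j, if e j = 0 then 0 else contractH x M p j
    (Submodule.Quotient.mk ⟨comp (p + 1) g (e - Finsupp.single j 1), hcyc _⟩)) = _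
  rw [hs', mk_eq_mk_iff]
  have := congrFun (congrArg (comp p) hgk) e
  rw [comp_ofComp] at this
  rw [this, ← comp_dT]
  refine ⟨-comp (p + 1) k e, ?_⟩
  rw [map_neg, ← comp_dx]
  ext s
  simp [comp]

theorem exact_approxD (hd : IsDSequence x M) (p : ℕ) :
    Function.Exact (approxD x M (p + 1)) (approxD x M p) := by
  intro z
  refine ⟨fun hz => ?_, ?_⟩
  · obtain ⟨c, hc, hzc, hsupp⟩ := exists_lift x (p + 1) z
    obtain ⟨n, hn⟩ := exists_trunc_ofComp_eq (p + 1) c _ hsupp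
    have hb : ∀ e, (∑ j, if e j = 0 then 0 else
        contract R M p j (c (e - Finsupp.single j 1))) ∈ boundaries x M p := fun e => by
      have h0 : coeffEquiv R r _ (approxD x M p z) e = 0 := by
        rw [hz, map_zero, Finsupp.zero_apply]
      rw [coeffEquiv_approxD] at h0
      simp only [hzc] at h0
      obtain ⟨hs, hs'⟩ := sum_contractH_mk x p c hc e
      rw [hs', ← Submodule.Quotient.mk_zero] at h0
      simpa using (mk_eq_mk_iff x hs (zero_mem _)).mp h0
    choose h hh using hb
    have hcycle : IsApproxCycle x (ofComp (p + 1) c) := by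
      refine ⟨comp_ext fun q e => ?_, ⟨ofComp (p + 1) h, comp_ext fun q e => ?_⟩, fun m => ?_⟩
      · rw [comp_dx, comp_zero]
        by_cases hq : q = p
        · subst hq
          rw [comp_ofComp]
          exact hc e
        · rw [comp_ofComp_of_ne (by omega), map_zero]
      · rw [comp_dx, comp_dT]
        by_cases hq : q = p
        · subst hq
          rw [comp_ofComp, comp_ofComp, hh]
        · simp [comp_ofComp_of_ne (show q + 1 ≠ p + 1 by omega)]
      -- The chain degree is positive, so there is no e_∅ coefficient to evaluate.
      · rw [ev_eq_zero]
        · exact zero_mem _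
        · intro e
          simp [ofComp]
    obtain ⟨g, k, hg, hgk, hng⟩ := hd.exists_bounded hcycle hn
    exact exists_approxD_eq x hc hzc hg hgk hng
  · rintro ⟨y, rfl⟩
    exact LinearMap.congr_fun (approxD_comp_approxD x M p) y

theorem IsClass.grComponent_eq {x : Fin r → R} {n : ℕ} {m : M} {z : Gr x M}
    (h : IsClass x M n m z) (k : ℕ) :
    ∃ y : powSub x M k, (y : M) = (if n = k then m else 0) ∧
      grComponent x M k z = Submodule.Quotient.mk y := by
  obtain ⟨hm, rfl⟩ := h
  by_cases hnk : n = k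
  · subst hnk
    exact ⟨⟨m, hm⟩, by simp, grComponent_grOf_self x M n _⟩
  · exact ⟨0, by simp [hnk], grComponent_grOf_of_ne x M hnk _⟩

theorem sum_mem_powSub_of_sum_eq_zero {ι : Type*} {x : Fin r → R} (t : Finset ι) (n : ι → ℕ)
    (m : ι → M) (z : ι → Gr x M) (h : ∀ i, IsClass x M (n i) (m i) (z i))
    (hz : ∑ i ∈ t, z i = 0) (k : ℕ) :
    ∑ i ∈ t, (if n i = k then m i else 0) ∈ powSub x M (k + 1) := by
  choose y hy hy' using fun i => (h i).grComponent_eq k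
  have h0 := congrArg (grComponent x M k) hz
  rw [map_sum, map_zero] at h0
  simp only [hy'] at h0
  have h1 : ((powSub x M (k + 1)).submoduleOf (powSub x M k)).mkQ (∑ i ∈ t, y i) = 0 := by
    rw [map_sum]
    exact h0
  rw [← LinearMap.mem_ker, Submodule.ker_mkQ] at h1
  have h2 : ((∑ i ∈ t, y i : powSub x M k) : M) ∈ powSub x M (k + 1) := h1
  rw [AddSubmonoidClass.coe_finsetSum] at h2
  simpa only [hy] using h2

theorem exact_approxD_approxAug (hd : IsDSequence x M) :
    Function.Exact (approxD x M 0) (approxAug x M) := by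
  intro z
  refine ⟨fun hz => ?_, ?_⟩
  · obtain ⟨c, hc, hzc, hsupp⟩ := exists_lift x 0 z
    obtain ⟨n, hn⟩ := exists_trunc_ofComp_eq 0 c _ hsupp
    have hsum : ofComp 0 c = ∑ e ∈ (coeffEquiv R r _ z).support,
        Pi.single (fun i => (false, e i)) (c e ⟨∅, rfl⟩) := by
      refine comp_ext fun q e => ?_
      ext s
      have hsingle : ∀ e' : Fin r →₀ ℕ, (Pi.single (fun i => (false, e' i)) (c e' ⟨∅, rfl⟩) :
          PolyChain r M) (fun i => (decide (i ∈ s.1), e i)) =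
          if e' = e then if s.1 = ∅ then c e' ⟨∅, rfl⟩ else 0 else 0 := fun e' => by
        have : ((fun i => (decide (i ∈ s.1), e i)) = fun i => (false, e' i)) ↔
            e' = e ∧ s.1 = ∅ := by
          simp only [funext_iff, Prod.mk.injEq, decide_eq_false_iff_not, forall_and,
            Finset.eq_empty_iff_forall_notMem, DFunLike.ext_iff]
          exact ⟨fun h => ⟨fun i => (h.2 i).symm, h.1⟩, fun h => ⟨h.2, fun i => (h.1 i).symm⟩⟩
        rw [Pi.single_apply, ← ite_and]
        simp only [this]
      simp only [comp, Finset.sum_apply, hsingle, Finset.sum_ite_eq']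
      by_cases hq : q = 0
      · subst hq
        change comp 0 (ofComp 0 c) e s = _
        rw [comp_ofComp]
        have hs : s = ⟨∅, rfl⟩ := Subtype.ext (Finset.card_eq_zero.mp s.2)
        subst hs
        by_cases he : e ∈ (coeffEquiv R r _ z).support
        · simp only [he, if_true]
        · simp only [he, if_false, hsupp e he, Pi.zero_apply]
      · have hs : s.1 ≠ ∅ := fun h => hq (by rw [← s.2, h, Finset.card_empty])
        change comp q (ofComp 0 c) e s = _
        rw [comp_ofComp_of_ne hq]
        simp [hs]
    have haug : ∑ e ∈ (coeffEquiv R r _ z).support, MvPolynomial.monomial e (1 : R) •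
        koszulHZeroToGr x M (Submodule.Quotient.mk ⟨c e, hc e⟩) = 0 := by
      rw [← hz]
      conv_rhs => rw [eq_sum_coeffEquiv z]
      rw [Finsupp.sum, map_sum]
      refine Finset.sum_congr rfl fun e _ => ?_
      rw [approxAug_tmul, hzc]
    have hcl : ∀ e, IsClass x M e.degree ((∏ i, x i ^ e i) • c e ⟨∅, rfl⟩)
        (MvPolynomial.monomial e (1 : R) •
          koszulHZeroToGr x M (Submodule.Quotient.mk ⟨c e, hc e⟩)) := fun e => by
      have : IsClass x M 0 (c e ⟨∅, rfl⟩) (koszulHZeroToGr x M (Submodule.Quotient.mk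
        ⟨c e, hc e⟩)) := ⟨by simp [powSub], koszulHZeroToGr_mk x M ⟨c e, hc e⟩⟩
      exact this.monomial_smul e
    have hcycle : IsApproxCycle x (ofComp 0 c) := by
      refine ⟨comp_ext fun q e => ?_, ⟨0, comp_ext fun q e => ?_⟩, fun m => ?_⟩
      · rw [comp_dx, comp_ofComp_of_ne q.succ_ne_zero, map_zero, comp_zero]
      · rw [map_zero, comp_zero, comp_dT]
        simp [comp_ofComp_of_ne q.succ_ne_zero]
      -- Evaluation in degree m is ∑ x^e c_e over |e| = m. The augmentation kills z exactly when
      -- each such sum lies in (x)^{m+1} M.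
      · rw [hsum, map_sum]
        have := sum_mem_powSub_of_sum_eq_zero _ _ _ _ hcl haug m
        simpa only [ev_single, Finsupp.degree_eq_sum] using this
    obtain ⟨g, k, hg, hgk, hng⟩ := hd.exists_bounded hcycle hn
    exact exists_approxD_eq x hc hzc hg hgk hng
  · rintro ⟨y, rfl⟩
    exact LinearMap.congr_fun (approxAug_comp_approxD x M) y

end Translation

/-! ### Finite length -/

section FiniteLength

variable {R : Type u} [CommRing R] [IsLocalRing R]

/-- The maximal ideal kills every simple factor, so each step of a composition series costs one
power. -/
theorem exists_pow_smul_eq_zero_of_isFiniteLength {N : Type v} [AddCommGroup N] [Module R N]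
    (h : IsFiniteLength R N) :
    ∃ k : ℕ, ∀ a ∈ IsLocalRing.maximalIdeal R ^ k, ∀ z : N, a • z = 0 := by
  induction h with
  | of_subsingleton => exact ⟨0, fun _ _ _ => Subsingleton.elim _ _⟩
  | @of_simple_quotient N _ _ P _ _ ih =>
    obtain ⟨k, hk⟩ := ih
    have hP : ∀ a ∈ IsLocalRing.maximalIdeal R, ∀ z : N, a • z ∈ P := fun a ha z => by
      have hmax : (Module.annihilator R (N ⧸ P)).IsMaximal := IsSimpleModule.annihilator_isMaximal
      rw [← IsLocalRing.eq_maximalIdeal hmax, Module.mem_annihilator] at ha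
      have := ha (Submodule.Quotient.mk z)
      rwa [← Submodule.Quotient.mk_smul, Submodule.Quotient.mk_eq_zero] at this
    refine ⟨k + 1, fun a ha z => ?_⟩
    rw [pow_succ] at ha
    induction ha using Submodule.mul_induction_on' with
    | mem_mul_mem b hb c hc =>
      have := congrArg Subtype.val (hk b hb ⟨c • z, hP c hc z⟩)
      rwa [mul_smul]
    | add b _ c _ hb hc => rw [add_smul, hb, hc, add_zero]

variable {r : ℕ} {x : Fin r → R} {M : Type v} [AddCommGroup M] [Module R M]

theorem IsAmenable.gamma_eq_top (ha : IsAmenable x M) {p : ℕ} (hp : 0 < p) :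
    gamma (IsLocalRing.maximalIdeal R) R (KoszulH x M p) = ⊤ := by
  obtain ⟨k, hk⟩ := exists_pow_smul_eq_zero_of_isFiniteLength (ha p hp)
  exact eq_top_iff.mpr fun z _ => ⟨k, fun a ha => hk a ha z⟩

theorem IsAmenable.contractH_mem_gamma (ha : IsAmenable x M) (j : Fin r)
    (a : KoszulH x M 1) :
    contractH x M 0 j a ∈ gamma (IsLocalRing.maximalIdeal R) R (KoszulH x M 0) := by
  obtain ⟨k, hk⟩ := exists_pow_smul_eq_zero_of_isFiniteLength (ha 1 one_pos)
  exact ⟨k, fun b hb => by rw [← map_smul, hk b hb, map_zero]⟩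

/-- The differential `S[-1] ⊗ H_1(x; M) → S ⊗ H^0_𝔪(H_0(x; M))` in the amenable case. -/
noncomputable def IsAmenable.delta (ha : IsAmenable x M) :
    S R r ⊗[R] KoszulH x M 1 →ₗ[S R r]
      S R r ⊗[R] gamma (IsLocalRing.maximalIdeal R) R (KoszulH x M 0) :=
  ∑ j, (MvPolynomial.X j : S R r) •
    ((contractH x M 0 j).codRestrict _ (ha.contractH_mem_gamma j)).baseChange (S R r)

theorem IsAmenable.gammaIncl_comp_delta (ha : IsAmenable x M) :
    gammaIncl x M (IsLocalRing.maximalIdeal R) 0 ∘ₗ ha.delta = approxD x M 0 := by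
  refine TensorProduct.AlgebraTensorModule.ext fun s a => ?_
  simp [gammaIncl, IsAmenable.delta, approxD]

/-- The image of `approxD` from S ⊗ H_1 is torsion, so exactness descends along the injection
`gammaIncl`. -/
theorem exact_delta_gammaAug (hd : IsDSequence x M) (ha : IsAmenable x M) :
    Function.Exact ha.delta (gammaAug x M (IsLocalRing.maximalIdeal R)) := by
  intro z
  have h₁ : (gammaAug x M (IsLocalRing.maximalIdeal R) z : Gr x M) =
      approxAug x M (gammaIncl x M (IsLocalRing.maximalIdeal R) 0 z) := rfl
  have h₂ : ∀ y, gammaIncl x M (IsLocalRing.maximalIdeal R) 0 (ha.delta y) =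
      approxD x M 0 y := LinearMap.congr_fun ha.gammaIncl_comp_delta
  rw [← ZeroMemClass.coe_eq_zero, h₁, exact_approxD_approxAug x hd]
  refine exists_congr fun y => ?_
  rw [← h₂]
  exact (gamma_baseChange_injective _).eq_iff

theorem exact_approxD_delta (hd : IsDSequence x M) (ha : IsAmenable x M) :
    Function.Exact (approxD x M 1) ha.delta := by
  intro z
  rw [← exact_approxD x hd 0 z, ← ha.gammaIncl_comp_delta, LinearMap.comp_apply]
  exact (map_eq_zero_iff _ (gamma_baseChange_injective _)).symm

theorem gammaAug_surjective (hd : IsDSequence x M) (ha : IsAmenable x M) :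
    Function.Surjective (gammaAug x M (IsLocalRing.maximalIdeal R)) := by
  rintro ⟨z, k, hk⟩
  obtain ⟨y, rfl⟩ := approxAug_surjective x M z
  obtain ⟨l, hl⟩ := exists_pow_smul_eq_zero_of_isFiniteLength (ha 1 one_pos)
  have hl' : ∀ a ∈ IsLocalRing.maximalIdeal R ^ l, ∀ w : S R r ⊗[R] KoszulH x M 1,
      a • w = 0 := fun a ha' w => by
    refine (coeffEquiv R r _).injective ?_
    ext e
    rw [map_smul, Finsupp.smul_apply, hl a ha', map_zero, Finsupp.zero_apply]
  -- For c ∈ 𝔪^k the element c y is in the kernel of the augmentation, hence comes from S ⊗ H_1,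
  -- which 𝔪^l kills. So 𝔪^{l+k} kills the lift y.
  have hy : y ∈ gamma (IsLocalRing.maximalIdeal R) (S R r) (S R r ⊗[R] KoszulH x M 0) := by
    refine ⟨l + k, fun a ha' => ?_⟩
    rw [pow_add] at ha'
    induction ha' using Submodule.mul_induction_on' with
    | mem_mul_mem b hb c hc =>
      have h0 : approxAug x M (c • y) = 0 := by
        rw [← algebraMap_smul (S R r) c y, map_smul, algebraMap_smul, hk c hc]
      obtain ⟨w, hw⟩ := (exact_approxD_approxAug x hd _).mp h0
      rw [mul_smul, ← hw, ← algebraMap_smul (S R r) b, ← map_smul, algebraMap_smul, hl' b hb,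
        map_zero]
    | add b _ c _ hb hc => rw [add_smul, hb, hc, add_zero]
  rw [← range_gamma_baseChange] at hy
  obtain ⟨w, rfl⟩ := hy
  exact ⟨w, rfl⟩

end FiniteLength

end KoszulApprox

open KoszulApprox IsLocalRing in
theorem mainTheorem3 {R : Type*} [CommRing R] [IsLocalRing R] [IsNoetherianRing R]
    {M : Type*} [AddCommGroup M] [Module R M] [Module.Finite R M]
    (hdim : 0 < Module.supportDim R M)
    {r : ℕ} (hr : 0 < r) (x : Fin r → R)
    (hx : IsPartialSystemOfParameters x M) (hseq : IsDSequence x M) :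
    -- the terms and their gradings
    (∀ p, IsGradedModule r (gammaDeg x M (maximalIdeal R) p)) ∧
    IsGradedModule r (gammaGrDeg x M (maximalIdeal R)) ∧
    (∀ p, r < p → Subsingleton (S R r ⊗[R] gamma (maximalIdeal R) R (KoszulH x M p))) ∧
    -- the maps are homogeneous of degree `0` and compose to zero
    (∀ p, IsGradedMap (gammaDeg x M (maximalIdeal R) (p + 1)) (gammaDeg x M (maximalIdeal R) p)
      (gammaD x M (maximalIdeal R) p)) ∧
    IsGradedMap (gammaDeg x M (maximalIdeal R) 0) (gammaGrDeg x M (maximalIdeal R))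
      (gammaAug x M (maximalIdeal R)) ∧
    (∀ p, gammaD x M (maximalIdeal R) p ∘ₗ gammaD x M (maximalIdeal R) (p + 1) = 0) ∧
    gammaAug x M (maximalIdeal R) ∘ₗ gammaD x M (maximalIdeal R) 0 = 0 ∧
    -- the complex is `H^0_𝔪` of the approximation complex
    (∀ p, Function.Injective (gammaIncl x M (maximalIdeal R) p) ∧
      LinearMap.range (gammaIncl x M (maximalIdeal R) p) =
        gamma (maximalIdeal R) (S R r) (S R r ⊗[R] KoszulH x M p)) ∧
    (∀ p, gammaIncl x M (maximalIdeal R) p ∘ₗ gammaD x M (maximalIdeal R) p =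
      approxD x M p ∘ₗ gammaIncl x M (maximalIdeal R) (p + 1)) ∧
    (gamma (maximalIdeal R) (S R r) (Gr x M)).subtype ∘ₗ gammaAug x M (maximalIdeal R) =
      approxAug x M ∘ₗ gammaIncl x M (maximalIdeal R) 0 ∧
    -- the amenable case
    (IsAmenable x M →
      (∀ p, 0 < p → gamma (maximalIdeal R) R (KoszulH x M p) = ⊤) ∧
      (∀ p, IsGradedModule r (koszulDeg x M p)) ∧
      (∀ p, r < p → Subsingleton (S R r ⊗[R] KoszulH x M p)) ∧
      (∀ p, IsGradedMap (koszulDeg x M (p + 1)) (koszulDeg x M p) (approxD x M p)) ∧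
      ∃ δ : S R r ⊗[R] KoszulH x M 1 →ₗ[S R r]
          S R r ⊗[R] gamma (maximalIdeal R) R (KoszulH x M 0),
        gammaIncl x M (maximalIdeal R) 0 ∘ₗ δ = approxD x M 0 ∧
        IsGradedMap (koszulDeg x M 1) (gammaDeg x M (maximalIdeal R) 0) δ ∧
        (∀ p, 0 < p → Function.Exact (approxD x M (p + 1)) (approxD x M p)) ∧
        Function.Exact (approxD x M 1) δ ∧
        Function.Exact δ (gammaAug x M (maximalIdeal R)) ∧
        Function.Surjective (gammaAug x M (maximalIdeal R))) := by
  refine ⟨fun p => isGradedModule_tensorDeg p, isGradedModule_gammaGrDeg x M _, fun p hp => ?_,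
    fun p => isGradedMap_sum_X_smul _ p, isGradedMap_gammaAug x M _,
    gammaD_comp_gammaD x M _, gammaAug_comp_gammaD x M _,
    fun p => ⟨gamma_baseChange_injective _, range_gamma_baseChange _⟩,
    gammaIncl_comp_gammaD x M _, subtype_comp_gammaAug x M _,
    fun ha => ⟨fun p hp => ha.gamma_eq_top hp, fun p => isGradedModule_tensorDeg p,
      fun p hp => ?_, fun p => isGradedMap_sum_X_smul _ p, ha.delta, ha.gammaIncl_comp_delta,
      isGradedMap_sum_X_smul _ 0, fun p _ => exact_approxD x hseq p, exact_approxD_delta hseq ha,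
      exact_delta_gammaAug hseq ha, gammaAug_surjective hseq ha⟩⟩
  · have := subsingleton_koszulH x M hp
    exact subsingleton_tensorProduct
  -- Vanishing beyond r, combined with exactness, gives injectivity at the left end.
  · have := subsingleton_koszulH x M hp
    exact subsingleton_tensorProduct
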